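/- Consider online maximum cardinality matching with free disposal on Forests. The edges of a finite forest $G$ arrive one at a time, in an arbitrary order chosen in advance by an adversary, so that an arriving edge may start a new tree, attach a new leaf to a tree, or merge two trees; neither $G$ nor the order is known to the algorithm. The algorithm maintains a matching, initially empty. When an edge $e$ arrives, it must immediately and irrevocably replace its current matching $M$ by a matching $M'\subseteq M\cup\{e\}$, possibly at random: matched edges may be disposed of, but an edge that was rejected at its arrival or disposed of later cannot be matched again. There is a $5/8$-competitive randomized algorithm for this problem, i.e. a randomized online algorithm such that, for every finite forest $G$ and every arrival order of its edges, the matching $M$ that it holds after all the edges have arrived satisfies $$\mathbb{E}\,|M| \;\ge\; \tfrac58\,\nu(G),$$ where $\nu(G)$ is the maximum cardinality of a matching in $G$. (Since the algorithm does not know when the input ends, the same holds at every moment, with the forest formed by the edges that have arrived so far.) -/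

import Mathlib

open scoped ENNReal

/-- A finite set of edges is a matching if no vertex lies on two different edges of it. -/
def IsEdgeMatching {V : Type*} (M : Finset (Sym2 V)) : Prop :=
  ∀ e ∈ M, ∀ f ∈ M, ∀ v : V, v ∈ e → v ∈ f → e = f

/-- A sequence of arriving edges is an input of the Forests model: the edges are distinct, none is
a loop, and the graph that they form has no cycle. The order is arbitrary, so that an arriving edge
may start a new tree, add a leaf to a tree, or merge two trees. -/
def IsForestInput {V : Type*} (σ : List (Sym2 V)) : Prop :=
  σ.Nodup ∧ (∀ e ∈ σ, ¬ e.IsDiag) ∧ (SimpleGraph.fromEdgeSet {e | e ∈ σ}).IsAcyclic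

open Classical in
/-- The maximum cardinality of a matching in the graph formed by the edges of `σ`. -/
noncomputable def maxMatchingSize {V : Type*} (σ : List (Sym2 V)) : ℕ :=
  (σ.toFinset.powerset.filter IsEdgeMatching).sup Finset.card

/-- What an online algorithm has seen and done so far, most recent event first: each arrived edge
together with the matching held just after the algorithm processed it. -/
abbrev Transcript (V : Type*) : Type _ := List (Sym2 V × Finset (Sym2 V))

/-- The matching held at the end of a transcript (empty before the first arrival). -/
def Transcript.current {V : Type*} : Transcript V → Finset (Sym2 V)
  | [] => ∅
  | (_, M) :: _ => M

/-- A randomized online matching algorithm with free disposal, for graphs with vertices in `V`.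
When an edge `e` arrives it draws its new matching at random, from a distribution that
depends only on the transcript so far and on `e`. The new matching may contain `e` and edges of the
old matching, and nothing else: matched edges may be disposed of at will, while an edge that was
rejected at its arrival, or disposed of later, is lost. -/
structure RandomizedDisposalAlgorithm (V : Type*) where
  /-- The distribution of the new matching. -/
  step : Transcript V → Sym2 V → PMF (Finset (Sym2 V))
  /-- Only the arriving edge can be added. -/
  mem_of_step : ∀ (h : Transcript V) (e : Sym2 V), ∀ M ∈ (step h e).support,
    ∀ f ∈ M, f = e ∨ f ∈ h.current
  /-- The new edge set is a matching. -/
  isEdgeMatching_of_step : ∀ (h : Transcript V) (e : Sym2 V), ∀ M ∈ (step h e).support,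
    IsEdgeMatching M

namespace RandomizedDisposalAlgorithm

/-- The random transcript of the algorithm once the edges of `σ` have arrived, in this order. -/
noncomputable def run {V : Type*} (A : RandomizedDisposalAlgorithm V) (σ : List (Sym2 V)) :
    PMF (Transcript V) :=
  σ.foldl (fun p e => p.bind fun h => (A.step h e).map fun M => (e, M) :: h) (PMF.pure [])

/-- The expected cardinality of the matching held once the edges of `σ` have arrived. -/
noncomputable def expectedSize {V : Type*} (A : RandomizedDisposalAlgorithm V)
    (σ : List (Sym2 V)) : ℝ≥0∞ :=
  ∑' h : Transcript V, A.run σ h * (h.current.card : ℝ≥0∞)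

/-- The algorithm is `c`-competitive for maximum cardinality matching on Forests. The algorithm is
not told where the input ends, and an initial segment of an input is an input, so that the
guarantee holds after every arrival. -/
def IsCompetitiveOnForests {V : Type*} (A : RandomizedDisposalAlgorithm V) (c : ℝ≥0∞) : Prop :=
  ∀ σ : List (Sym2 V), IsForestInput σ → c * (maxMatchingSize σ : ℝ≥0∞) ≤ A.expectedSize σ

end RandomizedDisposalAlgorithm

/-! ### Potential of a fractional matching, and loads on independent coordinates. -/

section Potential

open Classical

variable {V : Type*}

/-! The algorithm knows the probability x(f) with which it holds each edge f. An arriving edge e =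
uv joins two vertex-disjoint parts of the forest, and the matchings held there are independent
(`law_mul`). If u and v have fractional degrees a and b, both are free with probability (1-a)(1-b),
and an edge f at u is the only obstacle with probability x(f)(1-b); symmetrically at v. Choosing the
conditional acceptance probabilities thus realizes every fractional step in which e gets z ≤
(1-a)(1-b) for free and takes over σ(f) ≤ x(f)(1-b), or x(f)(1-a), from each edge f at u, or at v;
with two obstacles e is rejected. A deterministic fractional problem remains.

Its invariant `Good` compares x with every matching N on every union of components that contains an
edge: credits exceed charges by at least 1/4. A vertex covered by N is charged 5/16, an uncovered
one the part of its level above 3/8; an edge is credited with its weight, plus a bonus if N misses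
both its ends. Against a maximum matching no bonus occurs, so the total weight is at least 2 · 5/16
· |N|. A single new edge gets weight 7/8, and then the surplus is exactly 1/4 both for N empty (7/8
+ 3/8 - 1/2 - 1/2) and for N = {e} (7/8 - 5/8).

The critical comparison matchings after an arrival are those that contain e: they cover u and v
although no old edge does. `exists_hub` describes the old potential around u in that situation: a
least value s - 1/16, plus a load L(f) for each edge f at u whose far end is covered. Taking σ(f) ≤
L(f) from f is then harmless: either the far end is covered and the load pays, or it is uncovered
and its charge falls by σ(f). With t the weight of e, the condition becomes s_u + s_v + t ≥ 3/8. The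
old invariant also gives cost(a) ≤ s_u + ΣL, so a highly saturated vertex offers much to take over.
`merge_capacity` shows that the available amounts suffice, while upper bounds on the amounts protect
the matchings that avoid e. `good_shift` assembles these estimates. -/

/-- The fractional degree of a vertex. -/
noncomputable def level (E : Finset (Sym2 V)) (x : Sym2 V → ℝ) (v : V) : ℝ :=
  ∑ f ∈ E with v ∈ f, x f

/-- The charge of an uncovered vertex at level `t`. -/
noncomputable def cost (t : ℝ) : ℝ := max 0 (t - 3 / 8)

/-- The extra credit of an edge of weight `t` both of whose ends are uncovered. -/
noncomputable def bonus (t : ℝ) : ℝ := max 0 ((t - 1 / 8) / 2)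

/-- The vertices on the edges of `N`. -/
def coveredSet (N : Finset (Sym2 V)) : Set V := {v | ∃ f ∈ N, v ∈ f}

/-- The edge `f` has no end in `c`. -/
def Misses (f : Sym2 V) (c : Set V) : Prop := ∀ w ∈ f, w ∉ c

/-- No edge of `E` leaves `W`. -/
def ClosedUnder (E : Finset (Sym2 V)) (W : Finset V) : Prop :=
  ∀ f ∈ E, ∀ w ∈ f, w ∈ W → ∀ w' ∈ f, w' ∈ W

/-- The credit of an edge. -/
noncomputable def edgeCredit (x : Sym2 V → ℝ) (c : Set V) (f : Sym2 V) : ℝ :=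
  x f + if Misses f c then bonus (x f) else 0

/-- The charge of a vertex. -/
noncomputable def vertexCharge (E : Finset (Sym2 V)) (x : Sym2 V → ℝ) (c : Set V) (w : V) : ℝ :=
  if w ∈ c then 5 / 16 else cost (level E x w)

/-- The surplus of the fractional matching `x` inside `W` against a matching that covers `c`. -/
noncomputable def potential (E : Finset (Sym2 V)) (x : Sym2 V → ℝ) (W : Finset V) (c : Set V) : ℝ :=
  ∑ f ∈ E with ∀ w ∈ f, w ∈ W, edgeCredit x c f - ∑ w ∈ W, vertexCharge E x c w

/-- The invariant that the fractional algorithm maintains. -/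
structure Good (E : Finset (Sym2 V)) (x : Sym2 V → ℝ) : Prop where
  nonneg : ∀ f ∈ E, 0 ≤ x f
  le_cap : ∀ f ∈ E, x f ≤ 7 / 8
  level_le : ∀ v, level E x v ≤ 1
  surplus : ∀ W : Finset V, ClosedUnder E W → (∃ f ∈ E, ∀ w ∈ f, w ∈ W) →
    ∀ N ⊆ E, IsEdgeMatching N → 1 / 4 ≤ potential E x W (coveredSet N)

/-- Every edge separates its two ends. -/
def Bridged (E : Finset (Sym2 V)) : Prop :=
  ∀ f ∈ E, ∀ u p, f = s(u, p) → u ≠ p ∧ ∃ B : Finset V, u ∉ B ∧ p ∈ B ∧ ClosedUnder (E.erase f) B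

theorem cost_nonneg (t : ℝ) : 0 ≤ cost t := le_max_left _ _
theorem le_cost (t : ℝ) : t - 3 / 8 ≤ cost t := le_max_right _ _
theorem bonus_nonneg (t : ℝ) : 0 ≤ bonus t := le_max_left _ _
theorem le_bonus (t : ℝ) : (t - 1 / 8) / 2 ≤ bonus t := le_max_right _ _

theorem cost_of_le {t : ℝ} (h : t ≤ 3 / 8) : cost t = 0 := max_eq_left (by linarith)
theorem cost_of_ge {t : ℝ} (h : 3 / 8 ≤ t) : cost t = t - 3 / 8 := max_eq_right (by linarith)
theorem bonus_of_le {t : ℝ} (h : t ≤ 1 / 8) : bonus t = 0 := max_eq_left (by linarith)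
theorem bonus_of_ge {t : ℝ} (h : 1 / 8 ≤ t) : bonus t = (t - 1 / 8) / 2 :=
  max_eq_right (by linarith)

theorem bonus_le_half {t : ℝ} (h : 0 ≤ t) : bonus t ≤ t / 2 := max_le (by linarith) (by linarith)

theorem bonus_sub_le {t r : ℝ} (hr : 0 ≤ r) : bonus t - bonus (t - r) ≤ r := by
  have h1 := le_bonus (t - r)
  have h2 := bonus_nonneg (t - r)
  have : bonus t ≤ bonus (t - r) + r := max_le (by linarith) (by linarith)
  linarith

theorem cost_sub_le {t r : ℝ} (hr : t ≤ r) : cost r - cost t ≤ r - t := by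
  have h1 := le_cost t
  have h2 := cost_nonneg t
  have : cost r ≤ cost t + (r - t) := max_le (by linarith) (by linarith)
  linarith

/-- The bonuses of the edges at one vertex add up to at most `3 / 8`. -/
theorem sum_bonus_le {ι : Type*} (I : Finset ι) (x : ι → ℝ) (h0 : ∀ i ∈ I, 0 ≤ x i)
    (h1 : ∀ i ∈ I, x i ≤ 7 / 8) (hs : ∑ i ∈ I, x i ≤ 1) : ∑ i ∈ I, bonus (x i) ≤ 3 / 8 := by
  -- One edge above 1/8 contributes at most (7/8 - 1/8)/2 by the cap; with two of them the total is
  -- at most (1 - 2/8)/2. Both bounds equal 3/8.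
  by_cases h : ∃ i ∈ I, 1 / 8 < x i
  · obtain ⟨i, hi, hxi⟩ := h
    rw [← Finset.add_sum_erase _ _ hi] at hs ⊢
    by_cases h' : ∃ j ∈ I.erase i, 1 / 8 < x j
    · obtain ⟨j, hj, hxj⟩ := h'
      rw [← Finset.add_sum_erase _ _ hj] at hs ⊢
      have : ∑ k ∈ (I.erase i).erase j, bonus (x k) ≤ ∑ k ∈ (I.erase i).erase j, x k / 2 :=
        Finset.sum_le_sum fun k hk => bonus_le_half
          (h0 k (Finset.mem_of_mem_erase (Finset.mem_of_mem_erase hk)))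
      rw [← Finset.sum_div] at this
      rw [bonus_of_ge hxi.le, bonus_of_ge hxj.le]
      linarith
    · push Not at h'
      rw [Finset.sum_eq_zero fun k hk => bonus_of_le (h' k hk), bonus_of_ge hxi.le]
      linarith [h1 i hi]
  · push Not at h
    rw [Finset.sum_eq_zero fun k hk => bonus_of_le (h k hk)]
    norm_num

/-- Loads on the coordinates of a family closed under exchanging single coordinates. -/
theorem exists_loads {α ι : Type*} (I : Finset ι) (F : Finset α) (hF : F.Nonempty) (d : α → ℝ)
    (P : α → ι → Prop) (k : ι → ℝ) (hk : ∀ i ∈ I, 0 ≤ k i)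
    (hex : ∀ i ∈ I, ∀ M ∈ F, ∀ N ∈ F, ∃ M' ∈ F, ∃ N' ∈ F, d M' + d N' = d M + d N ∧
      (P M' i ↔ P N i) ∧ (P N' i ↔ P M i) ∧ ∀ j ∈ I, j ≠ i → (P M' j ↔ P M j)) :
    ∃ L : ι → ℝ, ∃ S ∈ F, (∀ i ∈ I, 0 ≤ L i ∧ L i ≤ k i) ∧
      (∀ N ∈ F, d S + ∑ i ∈ I with P N i, L i ≤ d N) ∧
      (∃ N ∈ F, d N + ∑ i ∈ I with ¬ P N i, k i ≤ d S + ∑ i ∈ I, L i) ∧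
      ∀ i ∈ I, 0 < L i → ¬ P S i := by
  obtain ⟨S, hS, hmin⟩ := F.exists_min_image d hF
  -- The load of i is the least excess over the minimum of `d` among members with `P` at i,
  -- truncated at `k i`; if there is no such member, it is `k i`.
  have hL : ∀ i, ∃ l : ℝ, i ∈ I → 0 ≤ l ∧ l ≤ k i ∧ (∀ N ∈ F, P N i → d S + l ≤ d N) ∧
      (l = k i ∨ ∃ N ∈ F, P N i ∧ d N = d S + l) := by
    intro i
    by_cases hi : i ∈ I
    · by_cases hne : (F.filter (P · i)).Nonempty
      · obtain ⟨B, hB, hBm⟩ := (F.filter (P · i)).exists_min_image d hne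
        rw [Finset.mem_filter] at hB
        refine ⟨min (k i) (d B - d S), fun _ => ⟨le_min (hk i hi) ?_, min_le_left _ _, ?_, ?_⟩⟩
        · linarith [hmin B hB.1]
        · intro N hN hPN
          have := hBm N (Finset.mem_filter.2 ⟨hN, hPN⟩)
          linarith [min_le_right (k i) (d B - d S)]
        · rcases min_choice (k i) (d B - d S) with h | h
          · exact Or.inl h
          · exact Or.inr ⟨B, hB.1, hB.2, by rw [h]; ring⟩
      · refine ⟨k i, fun _ => ⟨hk i hi, le_rfl, ?_, Or.inl rfl⟩⟩
        intro N hN hPN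
        exact absurd ⟨N, Finset.mem_filter.2 ⟨hN, hPN⟩⟩ hne
    · exact ⟨0, fun h => absurd h hi⟩
  choose L hL using hL
  refine ⟨L, S, hS, fun i hi => ⟨(hL i hi).1, (hL i hi).2.1⟩, ?_, ?_, ?_⟩
  · have key : ∀ Q ⊆ I, ∀ N ∈ F, d S + ∑ i ∈ Q with P N i, L i ≤ d N := by
      intro Q
      induction Q using Finset.induction_on with
      | empty => intro _ N hN; simpa using hmin N hN
      | insert i Q hiQ ih =>
        intro hQ N hN
        have hi : i ∈ I := hQ (Finset.mem_insert_self _ _)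
        have hQ' : Q ⊆ I := fun j hj => hQ (Finset.mem_insert_of_mem hj)
        by_cases hP : P N i
        · rw [Finset.filter_insert, if_pos hP, Finset.sum_insert (by simp [hiQ])]
          -- Exchanging coordinate i with the minimizer splits the excess of `N`: `N'` pays for i
          -- alone, `M'` for the remaining coordinates.
          obtain ⟨M', hM', N', hN', hd, hMi, hNi, hj⟩ := hex i hi N hN S hS
          have h1 := (hL i hi).2.2.1 N' hN' (hNi.2 hP)
          have h2 := ih hQ' M' hM'
          have h3 : Q.filter (P M' ·) = Q.filter (P N ·) := by
            refine Finset.filter_congr fun j hjQ => hj j (hQ' hjQ) ?_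
            rintro rfl; exact hiQ hjQ
          rw [h3] at h2
          linarith
        · rw [Finset.filter_insert, if_neg hP]
          exact ih hQ' N hN
    exact key I subset_rfl
  · have key : ∀ Q ⊆ I, ∃ N ∈ F, d N + ∑ i ∈ Q with ¬ P N i, k i ≤ d S + ∑ i ∈ Q, L i := by
      intro Q
      induction Q using Finset.induction_on with
      | empty => intro _; exact ⟨S, hS, by simp⟩
      | insert i Q hiQ ih =>
        intro hQ
        have hi : i ∈ I := hQ (Finset.mem_insert_self _ _)
        have hQ' : Q ⊆ I := fun j hj => hQ (Finset.mem_insert_of_mem hj)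
        obtain ⟨N, hN, hNd⟩ := ih hQ'
        rw [Finset.sum_insert hiQ]
        by_cases hP : P N i
        · refine ⟨N, hN, ?_⟩
          rw [Finset.filter_insert, if_neg (not_not.2 hP)]
          linarith [(hL i hi).1]
        · rcases (hL i hi).2.2.2 with hlk | ⟨B, hB, hPB, hdB⟩
          · refine ⟨N, hN, ?_⟩
            rw [Finset.filter_insert, if_pos hP, Finset.sum_insert (by simp [hiQ])]
            linarith
          -- The load is not truncated here, so importing coordinate i from `B` raises `d` by at
          -- most `L i`, because the partner `N'` is no smaller than the minimum.
          · obtain ⟨M', hM', N', hN', hd, hMi, hNi, hj⟩ := hex i hi N hN B hB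
            refine ⟨M', hM', ?_⟩
            rw [Finset.filter_insert, if_neg (not_not.2 (hMi.2 hPB))]
            have h3 : Q.filter (¬ P M' ·) = Q.filter (¬ P N ·) := by
              refine Finset.filter_congr fun j hjQ => not_congr (hj j (hQ' hjQ) ?_)
              rintro rfl; exact hiQ hjQ
            rw [h3]
            linarith [hmin N' hN']
    exact key I subset_rfl
  · intro i hi hpos hP
    linarith [(hL i hi).2.2.1 S hS hP]

theorem level_nonneg {E : Finset (Sym2 V)} {x : Sym2 V → ℝ} (h : ∀ f ∈ E, 0 ≤ x f) (v : V) :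
    0 ≤ level E x v :=
  Finset.sum_nonneg fun f hf => h f (Finset.mem_filter.1 hf).1

theorem edgeCredit_congr {x : Sym2 V → ℝ} {c c' : Set V} {f : Sym2 V}
    (h : ∀ w ∈ f, (w ∈ c ↔ w ∈ c')) : edgeCredit x c f = edgeCredit x c' f := by
  have : Misses f c ↔ Misses f c' := forall₂_congr fun w hw => not_congr (h w hw)
  simp [edgeCredit, this]

theorem vertexCharge_congr {E : Finset (Sym2 V)} {x : Sym2 V → ℝ} {c c' : Set V} {w : V}
    (h : w ∈ c ↔ w ∈ c') : vertexCharge E x c w = vertexCharge E x c' w := by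
  simp [vertexCharge, h]

/-- The potential of `W` depends only on the covered vertices in `W`. -/
theorem potential_congr {E : Finset (Sym2 V)} {x : Sym2 V → ℝ} {W : Finset V} {c c' : Set V}
    (h : ∀ w ∈ W, (w ∈ c ↔ w ∈ c')) : potential E x W c = potential E x W c' := by
  unfold potential
  congr 1
  · refine Finset.sum_congr rfl fun f hf => edgeCredit_congr fun w hw => h w ?_
    exact (Finset.mem_filter.1 hf).2 w hw
  · exact Finset.sum_congr rfl fun w hw => vertexCharge_congr (h w hw)

/-- The potential is additive over the two sides of a cut that no edge of `W` crosses. -/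
theorem potential_add {E : Finset (Sym2 V)} {x : Sym2 V → ℝ} {W B : Finset V} (c : Set V)
    (hB : B ⊆ W) (hcl : ClosedUnder E B) :
    potential E x W c = potential E x B c + potential E x (W \ B) c := by
  have h1 : E.filter (fun f => ∀ w ∈ f, w ∈ W) =
      E.filter (fun f => ∀ w ∈ f, w ∈ B) ∪ E.filter (fun f => ∀ w ∈ f, w ∈ W \ B) := by
    ext f
    simp only [Finset.mem_filter, Finset.mem_union, Finset.mem_sdiff]
    constructor
    · rintro ⟨hf, hW⟩
      by_cases h : ∃ w ∈ f, w ∈ B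
      · obtain ⟨w, hw, hwB⟩ := h
        exact Or.inl ⟨hf, hcl f hf w hw hwB⟩
      · push Not at h
        exact Or.inr ⟨hf, fun w hw => ⟨hW w hw, h w hw⟩⟩
    · rintro (⟨hf, h⟩ | ⟨hf, h⟩)
      · exact ⟨hf, fun w hw => hB (h w hw)⟩
      · exact ⟨hf, fun w hw => (h w hw).1⟩
  have h2 : Disjoint (E.filter (fun f => ∀ w ∈ f, w ∈ B))
      (E.filter (fun f => ∀ w ∈ f, w ∈ W \ B)) := by
    rw [Finset.disjoint_left]
    intro f hf hf'
    rw [Finset.mem_filter] at hf hf'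
    induction f using Sym2.ind with
    | _ a b =>
      exact (Finset.mem_sdiff.1 (hf'.2 a (Sym2.mem_mk_left a b))).2 (hf.2 a (Sym2.mem_mk_left a b))
  unfold potential
  rw [h1, Finset.sum_union h2, ← Finset.sum_sdiff hB (f := vertexCharge E x c)]
  ring

/-- The potential splits at a bridge `s(u, p)` between `B` and the rest of `W`. -/
theorem potential_split {E : Finset (Sym2 V)} {x : Sym2 V → ℝ} {W B : Finset V} (c : Set V)
    {u p : V} (hB : B ⊆ W) (hu : u ∈ W) (huB : u ∉ B) (hp : p ∈ B) (he : s(u, p) ∈ E)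
    (hcl : ClosedUnder (E.erase s(u, p)) B) :
    potential E x W c =
      potential E x B c + potential E x (W \ B) c + edgeCredit x c s(u, p) := by
  have h1 : E.filter (fun f => ∀ w ∈ f, w ∈ W) =
      insert s(u, p) (E.filter (fun f => ∀ w ∈ f, w ∈ B) ∪
        E.filter (fun f => ∀ w ∈ f, w ∈ W \ B)) := by
    ext f
    simp only [Finset.mem_filter, Finset.mem_union, Finset.mem_sdiff, Finset.mem_insert]
    constructor
    · rintro ⟨hf, hW⟩
      by_cases hfe : f = s(u, p)
      · exact Or.inl hfe
      by_cases h : ∃ w ∈ f, w ∈ B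
      · obtain ⟨w, hw, hwB⟩ := h
        exact Or.inr (Or.inl ⟨hf, hcl f (Finset.mem_erase.2 ⟨hfe, hf⟩) w hw hwB⟩)
      · push Not at h
        exact Or.inr (Or.inr ⟨hf, fun w hw => ⟨hW w hw, h w hw⟩⟩)
    · rintro (rfl | ⟨hf, h⟩ | ⟨hf, h⟩)
      · refine ⟨he, fun w hw => ?_⟩
        rcases Sym2.mem_iff.1 hw with rfl | rfl
        · exact hu
        · exact hB hp
      · exact ⟨hf, fun w hw => hB (h w hw)⟩
      · exact ⟨hf, fun w hw => (h w hw).1⟩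
  have h2 : Disjoint (E.filter (fun f => ∀ w ∈ f, w ∈ B))
      (E.filter (fun f => ∀ w ∈ f, w ∈ W \ B)) := by
    rw [Finset.disjoint_left]
    intro f hf hf'
    rw [Finset.mem_filter] at hf hf'
    induction f using Sym2.ind with
    | _ a b =>
      exact (Finset.mem_sdiff.1 (hf'.2 a (Sym2.mem_mk_left a b))).2 (hf.2 a (Sym2.mem_mk_left a b))
  have h3 : s(u, p) ∉ E.filter (fun f => ∀ w ∈ f, w ∈ B) ∪
        E.filter (fun f => ∀ w ∈ f, w ∈ W \ B) := by
    simp [huB, hp]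
  unfold potential
  rw [h1, Finset.sum_insert h3, Finset.sum_union h2,
    ← Finset.sum_sdiff hB (f := vertexCharge E x c)]
  ring

theorem ClosedUnder.mono {E E' : Finset (Sym2 V)} {W : Finset V} (h : ClosedUnder E W)
    (hE : E' ⊆ E) : ClosedUnder E' W := fun f hf => h f (hE hf)

theorem ClosedUnder.inter {E : Finset (Sym2 V)} {W W' : Finset V} (h : ClosedUnder E W)
    (h' : ClosedUnder E W') : ClosedUnder E (W ∩ W') := by
  intro f hf w hw hwW w' hw'
  rw [Finset.mem_inter] at hwW ⊢
  exact ⟨h f hf w hw hwW.1 w' hw', h' f hf w hw hwW.2 w' hw'⟩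

theorem ClosedUnder.sdiff {E : Finset (Sym2 V)} {W W' : Finset V} (h : ClosedUnder E W)
    (h' : ClosedUnder E W') : ClosedUnder E (W \ W') := by
  intro f hf w hw hwW w' hw'
  rw [Finset.mem_sdiff] at hwW ⊢
  exact ⟨h f hf w hw hwW.1 w' hw', fun hc => hwW.2 (h' f hf w' hw' hc w hw)⟩

theorem IsEdgeMatching.subset {M N : Finset (Sym2 V)} (h : IsEdgeMatching M) (hN : N ⊆ M) :
    IsEdgeMatching N := fun e he f hf => h e (hN he) f (hN hf)

end Potential

/-! ### The potential around a vertex that is covered from outside. -/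

section Hub

open Classical

variable {V : Type*}

theorem Misses.anti {f : Sym2 V} {c c' : Set V} (h : Misses f c') (hc : c ⊆ c') : Misses f c :=
  fun w hw hwc => h w hw (hc hwc)

theorem misses_mk_iff {u p : V} {c : Set V} : Misses s(u, p) c ↔ u ∉ c ∧ p ∉ c := by
  simp [Misses]

/-- Replace the part of `M` inside `B` by that of `N`. -/
noncomputable def splice (B : Finset V) (M N : Finset (Sym2 V)) : Finset (Sym2 V) :=
  (M.filter fun f => ¬ ∀ w ∈ f, w ∈ B) ∪ N.filter fun f => ∀ w ∈ f, w ∈ B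

theorem mem_splice {B : Finset V} {M N : Finset (Sym2 V)} {f : Sym2 V} :
    f ∈ splice B M N ↔ (f ∈ M ∧ ¬ ∀ w ∈ f, w ∈ B) ∨ (f ∈ N ∧ ∀ w ∈ f, w ∈ B) := by
  simp only [splice, Finset.mem_union, Finset.mem_filter]

theorem splice_subset {E : Finset (Sym2 V)} {B : Finset V} {M N : Finset (Sym2 V)} (hM : M ⊆ E)
    (hN : N ⊆ E) : splice B M N ⊆ E := by
  intro f hf
  rcases mem_splice.1 hf with h | h
  · exact hM h.1
  · exact hN h.1

theorem covered_splice_of_mem {E : Finset (Sym2 V)} {B : Finset V} {M N : Finset (Sym2 V)}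
    (hB : ClosedUnder E B) (hM : M ⊆ E) (hN : N ⊆ E) {w : V} (hw : w ∈ B) :
    w ∈ coveredSet (splice B M N) ↔ w ∈ coveredSet N := by
  constructor
  · rintro ⟨f, hf, hwf⟩
    rcases mem_splice.1 hf with h | h
    · exact absurd (hB f (hM h.1) w hwf hw) h.2
    · exact ⟨f, h.1, hwf⟩
  · rintro ⟨f, hf, hwf⟩
    exact ⟨f, mem_splice.2 (Or.inr ⟨hf, hB f (hN hf) w hwf hw⟩), hwf⟩

theorem covered_splice_of_notMem {B : Finset V} {M N : Finset (Sym2 V)} {w : V} (hw : w ∉ B) :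
    w ∈ coveredSet (splice B M N) ↔ w ∈ coveredSet M := by
  constructor
  · rintro ⟨f, hf, hwf⟩
    rcases mem_splice.1 hf with h | h
    · exact ⟨f, h.1, hwf⟩
    · exact absurd (h.2 w hwf) hw
  · rintro ⟨f, hf, hwf⟩
    exact ⟨f, mem_splice.2 (Or.inl ⟨hf, fun h => hw (h w hwf)⟩), hwf⟩

theorem isEdgeMatching_splice {E : Finset (Sym2 V)} {B : Finset V} {M N : Finset (Sym2 V)}
    (hB : ClosedUnder E B) (hM : M ⊆ E) (hMm : IsEdgeMatching M)
    (hNm : IsEdgeMatching N) : IsEdgeMatching (splice B M N) := by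
  intro e he f hf w hwe hwf
  rcases mem_splice.1 he with h | h <;> rcases mem_splice.1 hf with h' | h'
  · exact hMm e h.1 f h'.1 w hwe hwf
  · exact absurd (hB e (hM h.1) w hwe (h'.2 w hwf)) h.2
  · exact absurd (hB f (hM h'.1) w hwf (h.2 w hwe)) h'.2
  · exact hNm e h.1 f h'.1 w hwe hwf

/-- The vertices on the edges of `E`. -/
noncomputable def verts (E : Finset (Sym2 V)) : Finset V := E.biUnion Sym2.toFinset

theorem mem_verts {E : Finset (Sym2 V)} {w : V} : w ∈ verts E ↔ ∃ f ∈ E, w ∈ f := by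
  simp [verts]

/-- The connected component of `u`. -/
noncomputable def comp (E : Finset (Sym2 V)) (u : V) : Finset V :=
  (insert u (verts E)).filter fun w => ∀ W : Finset V, ClosedUnder E W → u ∈ W → w ∈ W

theorem mem_comp_self (E : Finset (Sym2 V)) (u : V) : u ∈ comp E u := by
  simp +contextual [comp]

theorem comp_subset {E : Finset (Sym2 V)} {u : V} {W : Finset V} (hW : ClosedUnder E W)
    (hu : u ∈ W) : comp E u ⊆ W := fun _ hw => (Finset.mem_filter.1 hw).2 W hW hu

theorem closedUnder_comp (E : Finset (Sym2 V)) (u : V) : ClosedUnder E (comp E u) := by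
  intro f hf w hw hwC w' hw'
  refine Finset.mem_filter.2 ⟨Finset.mem_insert_of_mem (mem_verts.2 ⟨f, hf, hw'⟩), fun W hW hu => ?_⟩
  exact hW f hf w hw (comp_subset hW hu hwC) w' hw'

theorem closedUnder_insert_verts (E : Finset (Sym2 V)) (u : V) :
    ClosedUnder E (insert u (verts E)) :=
  fun f hf _ _ _ _ hw' => Finset.mem_insert_of_mem (mem_verts.2 ⟨f, hf, hw'⟩)

/-- The potential around `u` when `u` is covered from outside: `s - 1 / 16` is its least value, and
`L f` is the extra amount that is present when the other end of `f` is covered. -/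
structure Hub (E : Finset (Sym2 V)) (x : Sym2 V → ℝ) (u : V) (s : ℝ) (L : Sym2 V → ℝ) : Prop where
  load_nonneg : ∀ f ∈ E, u ∈ f → 0 ≤ L f
  load_le : ∀ f ∈ E, u ∈ f → L f ≤ bonus (x f)
  lower : ∀ N ⊆ E, IsEdgeMatching N → (∀ g ∈ N, u ∉ g) →
    s - 1 / 16 + ∑ f ∈ E with u ∈ f ∧ ¬ Misses f (coveredSet N), L f ≤
      potential E x (comp E u) (insert u (coveredSet N))
  cost_le : (∃ f ∈ E, u ∈ f) → cost (level E x u) ≤ s + ∑ f ∈ E with u ∈ f, L f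
  far : ∀ p, s(u, p) ∈ E → 0 < L s(u, p) → 5 / 8 ≤ s + cost (level E x p)

theorem level_eq_zero {E : Finset (Sym2 V)} {x : Sym2 V → ℝ} {u : V} (h : ∀ f ∈ E, u ∉ f) :
    level E x u = 0 := by
  rw [level, Finset.filter_false_of_mem h, Finset.sum_empty]

theorem comp_eq_singleton {E : Finset (Sym2 V)} {u : V} (h : ∀ f ∈ E, u ∉ f) : comp E u = {u} := by
  refine Finset.Subset.antisymm (comp_subset ?_ (Finset.mem_singleton_self u)) ?_
  · intro f hf w hw hwu
    rw [Finset.mem_singleton] at hwu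
    exact absurd (hwu ▸ hw) (h f hf)
  · exact Finset.singleton_subset_iff.2 (mem_comp_self E u)

/-- The component is a single vertex, whose potential when covered is -5/16 = -1/4 - 1/16. -/
theorem hub_of_isolated {E : Finset (Sym2 V)} {x : Sym2 V → ℝ} {u : V} (h : ∀ f ∈ E, u ∉ f) :
    Hub E x u (-1 / 4) 0 where
  load_nonneg f hf hu := absurd hu (h f hf)
  load_le f hf hu := absurd hu (h f hf)
  lower N hN _ _ := by
    have : E.filter (fun f => ∀ w ∈ f, w ∈ ({u} : Finset V)) = ∅ := by
      refine Finset.filter_false_of_mem fun f hf hw => ?_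
      induction f using Sym2.ind with
      | _ a b =>
        have := hw a (Sym2.mem_mk_left a b)
        rw [Finset.mem_singleton] at this
        exact h _ hf (this ▸ Sym2.mem_mk_left a b)
    rw [comp_eq_singleton h, potential, this]
    simp [vertexCharge]
    norm_num
  cost_le := by
    rintro ⟨f, hf, hu⟩
    exact absurd hu (h f hf)
  far p hp := absurd (Sym2.mem_mk_left u p) (h _ hp)

theorem misses_iff_of_avoid {N : Finset (Sym2 V)} {u p : V} (h : ∀ g ∈ N, u ∉ g) :
    Misses s(u, p) (coveredSet N) ↔ p ∉ coveredSet N := by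
  rw [misses_mk_iff, and_iff_right]
  rintro ⟨g, hg, hu⟩
  exact h g hg hu

/-- Two matchings can exchange their parts behind one edge at a covered vertex. -/
theorem exists_exchange {E : Finset (Sym2 V)} (x : Sym2 V → ℝ) (hE : Bridged E) {W : Finset V}
    {u p : V} (hW : ClosedUnder E W) (hu : u ∈ W) (he : s(u, p) ∈ E)
    {M N : Finset (Sym2 V)} (hM : M ⊆ E) (hMm : IsEdgeMatching M) (hMu : ∀ g ∈ M, u ∉ g)
    (hN : N ⊆ E) (hNm : IsEdgeMatching N) (hNu : ∀ g ∈ N, u ∉ g) :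
    ∃ M' ⊆ E, IsEdgeMatching M' ∧ (∀ g ∈ M', u ∉ g) ∧
      ∃ N' ⊆ E, IsEdgeMatching N' ∧ (∀ g ∈ N', u ∉ g) ∧
      potential E x W (insert u (coveredSet M')) + potential E x W (insert u (coveredSet N')) =
        potential E x W (insert u (coveredSet M)) + potential E x W (insert u (coveredSet N)) ∧
      (Misses s(u, p) (coveredSet M') ↔ Misses s(u, p) (coveredSet N)) ∧
      (Misses s(u, p) (coveredSet N') ↔ Misses s(u, p) (coveredSet M)) ∧
      ∀ g ∈ E, u ∈ g → g ≠ s(u, p) → (Misses g (coveredSet M') ↔ Misses g (coveredSet M)) := by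
  obtain ⟨hup, B₀, huB₀, hpB₀, hB₀⟩ := hE _ he u p rfl
  have hpW : p ∈ W := hW _ he u (Sym2.mem_mk_left _ _) hu p (Sym2.mem_mk_right _ _)
  -- The part of `W` behind the bridge; the exchanged matchings swap their edges inside it.
  set B := B₀ ∩ W with hBdef
  have huB : u ∉ B := fun h => huB₀ (Finset.mem_inter.1 h).1
  have hpB : p ∈ B := Finset.mem_inter.2 ⟨hpB₀, hpW⟩
  have hB : ClosedUnder (E.erase s(u, p)) B := hB₀.inter (hW.mono (Finset.erase_subset _ _))
  have hsub : ∀ K ⊆ E, (∀ g ∈ K, u ∉ g) → K ⊆ E.erase s(u, p) := by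
    intro K hK hKu g hg
    refine Finset.mem_erase.2 ⟨?_, hK hg⟩
    rintro rfl
    exact hKu _ hg (Sym2.mem_mk_left _ _)
  have hM₀ := hsub M hM hMu
  have hN₀ := hsub N hN hNu
  have hav : ∀ K K' : Finset (Sym2 V), (∀ g ∈ K, u ∉ g) → (∀ g ∈ K', u ∉ g) →
      ∀ g ∈ splice B K K', u ∉ g := by
    intro K K' hK hK' g hg
    rcases mem_splice.1 hg with h | h
    · exact hK g h.1
    · exact hK' g h.1
  have hpot : ∀ K K' : Finset (Sym2 V), K ⊆ E.erase s(u, p) → K' ⊆ E.erase s(u, p) →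
      potential E x W (insert u (coveredSet (splice B K K'))) =
        potential E x B (insert u (coveredSet K')) +
        potential E x (W \ B) (insert u (coveredSet K)) + x s(u, p) := by
    intro K K' hK hK'
    -- Since u counts as covered, the bridge carries no bonus and its credit is constant; hence the
    -- potential separates over the two sides.
    rw [potential_split _ Finset.inter_subset_right hu huB hpB he hB]
    congr 1
    · congr 1
      · refine potential_congr fun w hw => ?_
        rw [Set.mem_insert_iff, Set.mem_insert_iff, covered_splice_of_mem hB hK hK' hw]
      · refine potential_congr fun w hw => ?_
        rw [Set.mem_insert_iff, Set.mem_insert_iff,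
          covered_splice_of_notMem (Finset.mem_sdiff.1 hw).2]
    · simp [edgeCredit, misses_mk_iff]
  have hself : ∀ K : Finset (Sym2 V), splice B K K = K := by
    intro K; ext g; rw [mem_splice]; tauto
  refine ⟨splice B M N, splice_subset hM hN, isEdgeMatching_splice hB hM₀ hMm hNm,
    hav M N hMu hNu, splice B N M, splice_subset hN hM, isEdgeMatching_splice hB hN₀ hNm hMm,
    hav N M hNu hMu, ?_, ?_, ?_, ?_⟩
  · have h1 := hpot M M hM₀ hM₀
    have h2 := hpot N N hN₀ hN₀
    rw [hself] at h1 h2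
    rw [hpot M N hM₀ hN₀, hpot N M hN₀ hM₀, h1, h2]
    ring
  · rw [misses_iff_of_avoid (hav M N hMu hNu), misses_iff_of_avoid hNu,
      covered_splice_of_mem hB hM₀ hN₀ hpB]
  · rw [misses_iff_of_avoid (hav N M hNu hMu), misses_iff_of_avoid hMu,
      covered_splice_of_mem hB hN₀ hM₀ hpB]
  · rintro g hg ⟨q, rfl⟩ hne
    rw [misses_iff_of_avoid (hav M N hMu hNu), misses_iff_of_avoid hMu,
      covered_splice_of_notMem]
    intro hq
    exact huB (hB _ (Finset.mem_erase.2 ⟨hne, hg⟩) q (Sym2.mem_mk_right _ _) hq u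
      (Sym2.mem_mk_left _ _))

/-- Covering one more vertex `p`. -/
theorem potential_insert_le {E : Finset (Sym2 V)} {x : Sym2 V → ℝ} {W : Finset V} {c : Set V}
    {p : V} (hp : p ∈ W) (hpc : p ∉ c) :
    potential E x W (insert p c) ≤ potential E x W c - 5 / 16 + cost (level E x p) := by
  have h1 : ∑ f ∈ E with ∀ w ∈ f, w ∈ W, edgeCredit x (insert p c) f ≤
      ∑ f ∈ E with ∀ w ∈ f, w ∈ W, edgeCredit x c f := by
    refine Finset.sum_le_sum fun f _ => ?_
    unfold edgeCredit
    by_cases h : Misses f (insert p c)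
    · rw [if_pos h, if_pos (h.anti (Set.subset_insert _ _))]
    · rw [if_neg h]
      split_ifs <;> linarith [bonus_nonneg (x f)]
  have h2 : ∑ w ∈ W, vertexCharge E x (insert p c) w =
      ∑ w ∈ W, vertexCharge E x c w + 5 / 16 - cost (level E x p) := by
    rw [← Finset.add_sum_erase _ _ hp, ← Finset.add_sum_erase W (vertexCharge E x c) hp]
    have : ∑ w ∈ W.erase p, vertexCharge E x (insert p c) w =
        ∑ w ∈ W.erase p, vertexCharge E x c w := by
      refine Finset.sum_congr rfl fun w hw => vertexCharge_congr ?_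
      rw [Set.mem_insert_iff, or_iff_right (Finset.mem_erase.1 hw).1]
    rw [this]
    simp [vertexCharge, hpc]
    ring
  unfold potential
  linarith

/-- Uncovering the vertex `u`. -/
theorem potential_eq_insert {E : Finset (Sym2 V)} {x : Sym2 V → ℝ} {W : Finset V} {c : Set V}
    {u : V} (hW : ClosedUnder E W) (hu : u ∈ W) (huc : u ∉ c) :
    potential E x W c = potential E x W (insert u c) + 5 / 16 - cost (level E x u) +
      ∑ f ∈ E with u ∈ f ∧ Misses f c, bonus (x f) := by
  have h1 : ∑ f ∈ E with ∀ w ∈ f, w ∈ W, edgeCredit x c f =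
      ∑ f ∈ E with ∀ w ∈ f, w ∈ W, edgeCredit x (insert u c) f +
      ∑ f ∈ E with u ∈ f ∧ Misses f c, bonus (x f) := by
    have : E.filter (fun f => u ∈ f ∧ Misses f c) =
        (E.filter fun f => ∀ w ∈ f, w ∈ W).filter fun f => u ∈ f ∧ Misses f c := by
      ext f
      simp only [Finset.mem_filter]
      exact ⟨fun h => ⟨⟨h.1, hW f h.1 u h.2.1 hu⟩, h.2⟩, fun h => ⟨h.1.1, h.2⟩⟩
    rw [this, Finset.sum_filter (s := E.filter _), ← Finset.sum_add_distrib]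
    refine Finset.sum_congr rfl fun f _ => ?_
    unfold edgeCredit
    by_cases huf : u ∈ f
    · have : ¬ Misses f (insert u c) := fun h => h u huf (Set.mem_insert _ _)
      simp [this, huf]
    · have : Misses f (insert u c) ↔ Misses f c := by
        refine forall₂_congr fun w hw => not_congr ?_
        rw [Set.mem_insert_iff, or_iff_right]
        rintro rfl; exact huf hw
      simp [this, huf]
  have h2 : ∑ w ∈ W, vertexCharge E x (insert u c) w =
      ∑ w ∈ W, vertexCharge E x c w + 5 / 16 - cost (level E x u) := by
    rw [← Finset.add_sum_erase _ _ hu, ← Finset.add_sum_erase W (vertexCharge E x c) hu]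
    have : ∑ w ∈ W.erase u, vertexCharge E x (insert u c) w =
        ∑ w ∈ W.erase u, vertexCharge E x c w := by
      refine Finset.sum_congr rfl fun w hw => vertexCharge_congr ?_
      rw [Set.mem_insert_iff, or_iff_right (Finset.mem_erase.1 hw).1]
    rw [this]
    simp [vertexCharge, huc]
    ring
  unfold potential
  linarith

theorem isEdgeMatching_insert {N : Finset (Sym2 V)} {e : Sym2 V} (hN : IsEdgeMatching N)
    (h : Misses e (coveredSet N)) : IsEdgeMatching (insert e N) := by
  intro f hf g hg w hwf hwg
  rcases Finset.mem_insert.1 hf with hfe | hfN <;> rcases Finset.mem_insert.1 hg with hge | hgN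
  · rw [hfe, hge]
  · exact absurd ⟨g, hgN, hwg⟩ (h w (hfe ▸ hwf))
  · exact absurd ⟨f, hfN, hwf⟩ (h w (hge ▸ hwg))
  · exact hN f hfN g hgN w hwf hwg

theorem coveredSet_insert_mk {N : Finset (Sym2 V)} {u p : V} :
    coveredSet (insert s(u, p) N) = insert p (insert u (coveredSet N)) := by
  ext w
  simp only [coveredSet, Finset.mem_insert, Set.mem_ofPred_eq, Set.mem_insert_iff]
  constructor
  · rintro ⟨f, rfl | hf, hw⟩
    · rcases Sym2.mem_iff.1 hw with rfl | rfl <;> simp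
    · exact Or.inr (Or.inr ⟨f, hf, hw⟩)
  · rintro (rfl | rfl | ⟨f, hf, hw⟩)
    · exact ⟨_, Or.inl rfl, Sym2.mem_mk_right _ _⟩
    · exact ⟨_, Or.inl rfl, Sym2.mem_mk_left _ _⟩
    · exact ⟨f, Or.inr hf, hw⟩

/-- Once u is covered, the branches at u do not interact, so `exists_loads` applies with one
coordinate per edge at u, the property "the far end is covered", and truncation at the bonus. -/
theorem exists_hub {E : Finset (Sym2 V)} {x : Sym2 V → ℝ} (hg : Good E x) (hE : Bridged E) {u : V}
    (hu : ∃ f ∈ E, u ∈ f) : ∃ s L, Hub E x u s L := by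
  have hW := closedUnder_comp E u
  have huW := mem_comp_self E u
  have hWe : ∃ f ∈ E, ∀ w ∈ f, w ∈ comp E u := by
    obtain ⟨f, hf, huf⟩ := hu
    exact ⟨f, hf, hW f hf u huf huW⟩
  let F : Finset (Finset (Sym2 V)) :=
    E.powerset.filter fun N => IsEdgeMatching N ∧ ∀ g ∈ N, u ∉ g
  have hF : ∀ N, N ∈ F ↔ N ⊆ E ∧ IsEdgeMatching N ∧ ∀ g ∈ N, u ∉ g := by
    intro N; rw [Finset.mem_filter, Finset.mem_powerset]
  obtain ⟨L, S, hS, hL, hlow, ⟨N, hN, hNd⟩, hfar⟩ :=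
    exists_loads (E.filter (u ∈ ·)) F ⟨∅, by simp [hF, IsEdgeMatching]⟩
      (fun N => potential E x (comp E u) (insert u (coveredSet N)))
      (fun N f => ¬ Misses f (coveredSet N)) (fun f => bonus (x f))
      (fun f _ => bonus_nonneg _) (by
        intro f hf M hM N hN
        obtain ⟨hf, p, rfl⟩ := Finset.mem_filter.1 hf
        rw [hF] at hM hN
        obtain ⟨M', h1, h2, h3, N', h4, h5, h6, h7, h8, h9, h10⟩ :=
          exists_exchange x hE hW huW hf hM.1 hM.2.1 hM.2.2 hN.1 hN.2.1 hN.2.2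
        refine ⟨M', (hF _).2 ⟨h1, h2, h3⟩, N', (hF _).2 ⟨h4, h5, h6⟩, h7, not_congr h8,
          not_congr h9, fun g hg hne => not_congr ?_⟩
        rw [Finset.mem_filter] at hg
        exact h10 g hg.1 hg.2 hne)
  rw [hF] at hS hN
  -- The offset 1/16 = 5/16 - 1/4 is what covering u costs beyond the guaranteed surplus; it removes
  -- the constant from `cost_le`.
  refine ⟨potential E x (comp E u) (insert u (coveredSet S)) + 1 / 16, L, ?_, ?_, ?_, ?_, ?_⟩
  · intro f hf huf
    exact (hL f (Finset.mem_filter.2 ⟨hf, huf⟩)).1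
  · intro f hf huf
    exact (hL f (Finset.mem_filter.2 ⟨hf, huf⟩)).2
  · intro N hN hNm hNu
    have := hlow N ((hF N).2 ⟨hN, hNm, hNu⟩)
    refine le_of_eq_of_le ?_ this
    rw [add_sub_cancel_right]
    congr 1
    refine Finset.sum_congr ?_ fun _ _ => rfl
    ext f
    simp only [Finset.mem_filter, and_assoc]
  · intro _
    -- Leaving u uncovered trades the charge 5/16 for the cost of u and regains the bonuses of the
    -- missed edges at u, which are exactly the terms bounded by the loads.
    have h1 := hg.surplus _ hW hWe N hN.1 hN.2.1
    rw [potential_eq_insert hW huW (by rintro ⟨g, hg, hug⟩; exact hN.2.2 g hg hug)] at h1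
    simp only [not_not, Finset.filter_filter] at hNd
    linarith
  · intro p hp hpos
    have hmiss := hfar _ (Finset.mem_filter.2 ⟨hp, Sym2.mem_mk_left _ _⟩) hpos
    rw [not_not] at hmiss
    -- A positive load means that the minimizer `S` misses the edge, so the edge can be added to
    -- `S`. Then 1/4 from the surplus, 5/16 for p and the offset 1/16 add up to 5/8.
    have h1 := hg.surplus _ hW hWe (insert s(u, p) S) (Finset.insert_subset hp hS.1)
      (isEdgeMatching_insert hS.2.1 hmiss)
    rw [coveredSet_insert_mk] at h1
    have hne := (hE _ hp u p rfl).1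
    have h2 := potential_insert_le (x := x) (E := E)
      (hW _ hp u (Sym2.mem_mk_left _ _) huW p (Sym2.mem_mk_right _ _))
      (c := insert u (coveredSet S)) (by
        rw [Set.mem_insert_iff, not_or]
        exact ⟨hne.symm, (misses_mk_iff.1 hmiss).2⟩)
    linarith

/-- A cost never exceeds 5/8, so `far` settles the case of a positive load; without one, `cost_le`
does. -/
theorem Hub.nonneg {E : Finset (Sym2 V)} {x : Sym2 V → ℝ} {u : V} {s : ℝ} {L : Sym2 V → ℝ}
    (h : Hub E x u s L) (hg : Good E x) (hu : ∃ f ∈ E, u ∈ f) : 0 ≤ s := by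
  by_cases hL : ∃ f ∈ E, u ∈ f ∧ 0 < L f
  · obtain ⟨f, hf, ⟨p, rfl⟩, hpos⟩ := hL
    have h1 := h.far p hf hpos
    have h2 : cost (level E x p) ≤ 5 / 8 := max_le (by norm_num) (by linarith [hg.level_le p])
    linarith
  · push Not at hL
    have h1 := h.cost_le hu
    have h2 : ∑ f ∈ E with u ∈ f, L f ≤ 0 := Finset.sum_nonpos fun f hf => by
      rw [Finset.mem_filter] at hf; exact hL f hf.1 hf.2
    linarith [cost_nonneg (level E x u)]

end Hub

/-! ### Preservation of the invariant under a fractional step. -/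

section Shift

open Classical

variable {V : Type*}

/-- The weights after the arrival of `e`, when `e` gets `z` for free and takes over `σ f` from every
edge `f`. -/
noncomputable def shift (E : Finset (Sym2 V)) (x : Sym2 V → ℝ) (e : Sym2 V) (z : ℝ)
    (σ : Sym2 V → ℝ) : Sym2 V → ℝ :=
  fun f => if f = e then z + ∑ g ∈ E, σ g else x f - σ f

theorem shift_self {E : Finset (Sym2 V)} {x : Sym2 V → ℝ} {e : Sym2 V} {z : ℝ} {σ : Sym2 V → ℝ} :
    shift E x e z σ e = z + ∑ g ∈ E, σ g := if_pos rfl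

theorem shift_of_mem {E : Finset (Sym2 V)} {x : Sym2 V → ℝ} {e : Sym2 V} {z : ℝ} {σ : Sym2 V → ℝ}
    (he : e ∉ E) {f : Sym2 V} (hf : f ∈ E) : shift E x e z σ f = x f - σ f :=
  if_neg (by rintro rfl; exact he hf)

theorem level_shift_of_notMem {E : Finset (Sym2 V)} {x : Sym2 V → ℝ} {e : Sym2 V} {z : ℝ}
    {σ : Sym2 V → ℝ} (he : e ∉ E) {w : V} (hw : w ∉ e) :
    level (insert e E) (shift E x e z σ) w = level E x w - ∑ f ∈ E with w ∈ f, σ f := by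
  unfold level
  rw [Finset.filter_insert, if_neg hw, ← Finset.sum_sub_distrib]
  exact Finset.sum_congr rfl fun f hf => shift_of_mem he (Finset.mem_filter.1 hf).1

theorem level_shift_of_mem {E : Finset (Sym2 V)} {x : Sym2 V → ℝ} {e : Sym2 V} {z : ℝ}
    {σ : Sym2 V → ℝ} (he : e ∉ E) {w : V} (hw : w ∈ e) :
    level (insert e E) (shift E x e z σ) w = level E x w + z + ∑ f ∈ E with w ∉ f, σ f := by
  unfold level
  rw [Finset.filter_insert, if_pos hw, Finset.sum_insert (by simp [he]), shift_self,
    ← Finset.sum_filter_add_sum_filter_not E (w ∈ ·) σ,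
    Finset.sum_congr rfl fun f hf => shift_of_mem he (Finset.mem_filter.1 hf).1,
    Finset.sum_sub_distrib]
  ring

/-- The total weight grows by z only, since `e` receives what the other edges lose. By `hX` the cost
is linear at each far end that is affected, so an uncovered far end of f returns σ f. This
compensates the lost bonus if f is missed, and is a net gain if u and v are both covered. -/
theorem le_potential_shift {E : Finset (Sym2 V)} {x : Sym2 V → ℝ} {u v : V} {z : ℝ}
    {σ : Sym2 V → ℝ} (hloop : ∀ f ∈ E, ∀ y p, f = s(y, p) → y ≠ p) (huv : u ≠ v)
    (he : s(u, v) ∉ E) (hσ : ∀ f ∈ E, 0 ≤ σ f) (hσ0 : ∀ f ∈ E, u ∉ f → v ∉ f → σ f = 0)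
    (hX : ∀ w, w ∉ s(u, v) → ∑ f ∈ E with w ∈ f, σ f = 0 ∨
      3 / 8 ≤ level E x w - ∑ f ∈ E with w ∈ f, σ f)
    {W : Finset V} (hW : ClosedUnder E W) (hu : u ∈ W) (hv : v ∈ W) (c : Set V) :
    potential E x W c + z + (if Misses s(u, v) c then bonus (z + ∑ f ∈ E, σ f) else 0) +
      (∑ f ∈ E, if u ∈ c ∧ v ∈ c ∧ ∃ w ∈ f, w ∉ c then σ f else 0) -
      (if u ∈ c then 0 else
        cost (level (insert s(u, v) E) (shift E x s(u, v) z σ) u) - cost (level E x u)) -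
      (if v ∈ c then 0 else
        cost (level (insert s(u, v) E) (shift E x s(u, v) z σ) v) - cost (level E x v)) ≤
      potential (insert s(u, v) E) (shift E x s(u, v) z σ) W c := by
  set e := s(u, v) with hedef
  set x' := shift E x e z σ with hx'
  set W0 := (W.erase u).erase v with hW0
  have hvW : v ∈ W.erase u := Finset.mem_erase.2 ⟨huv.symm, hv⟩
  have hedge : ∑ f ∈ insert e E with ∀ w ∈ f, w ∈ W, edgeCredit x' c f =
      edgeCredit x' c e + ∑ f ∈ E with ∀ w ∈ f, w ∈ W, edgeCredit x' c f := by
    rw [Finset.filter_insert, if_pos, Finset.sum_insert (by simp [he])]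
    intro w hw
    rcases Sym2.mem_iff.1 hw with rfl | rfl <;> assumption
  have hsplit : ∀ h : V → ℝ, ∑ w ∈ W, h w = h u + (h v + ∑ w ∈ W0, h w) := by
    intro h
    rw [← Finset.add_sum_erase _ _ hu, ← Finset.add_sum_erase _ _ hvW]
  have hvert : ∑ w ∈ W0, vertexCharge (insert e E) x' c w =
      ∑ w ∈ W0, vertexCharge E x c w - ∑ f ∈ E, ∑ w ∈ W0 with w ∉ c ∧ w ∈ f, σ f := by
    have : ∑ f ∈ E, ∑ w ∈ W0 with w ∉ c ∧ w ∈ f, σ f =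
        ∑ w ∈ W0, if w ∈ c then 0 else ∑ f ∈ E with w ∈ f, σ f := by
      simp only [Finset.sum_filter]
      rw [Finset.sum_comm]
      refine Finset.sum_congr rfl fun w _ => ?_
      by_cases hw : w ∈ c <;> simp [hw]
    rw [this, ← Finset.sum_sub_distrib]
    refine Finset.sum_congr rfl fun w hw => ?_
    by_cases hwc : w ∈ c
    · simp [vertexCharge, hwc]
    · have hwe : w ∉ e := by
        rw [hedef, Sym2.mem_iff, not_or]
        exact ⟨(Finset.mem_erase.1 (Finset.mem_erase.1 hw).2).1, (Finset.mem_erase.1 hw).1⟩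
      simp only [vertexCharge, if_neg hwc]
      rw [hx', level_shift_of_notMem he hwe]
      rcases hX w hwe with h | h
      · rw [h]; simp
      · have h0 : 0 ≤ ∑ f ∈ E with w ∈ f, σ f :=
          Finset.sum_nonneg fun f hf => hσ f (Finset.mem_filter.1 hf).1
        rw [cost_of_ge h, cost_of_ge (by linarith)]
        ring
  have hterm : ∑ f ∈ E with ∀ w ∈ f, w ∈ W, edgeCredit x c f +
      (∑ f ∈ E, if u ∈ c ∧ v ∈ c ∧ ∃ w ∈ f, w ∉ c then σ f else 0) ≤
      ∑ f ∈ E with ∀ w ∈ f, w ∈ W, edgeCredit x' c f + ∑ f ∈ E, σ f +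
      ∑ f ∈ E, ∑ w ∈ W0 with w ∉ c ∧ w ∈ f, σ f := by
    simp only [Finset.sum_filter (s := E)]
    rw [← Finset.sum_add_distrib, ← Finset.sum_add_distrib, ← Finset.sum_add_distrib]
    refine Finset.sum_le_sum fun f hf => ?_
    have hcredit : edgeCredit x' c f = x f - σ f + if Misses f c then bonus (x f - σ f) else 0 := by
      rw [edgeCredit, hx', shift_of_mem he hf]
    rw [hcredit, edgeCredit, Finset.sum_const, nsmul_eq_mul]
    rcases (hσ f hf).eq_or_lt with h0 | hpos
    · simp [← h0]
    have hmeet : u ∈ f ∨ v ∈ f := by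
      by_contra h
      rw [not_or] at h
      exact hpos.ne' (hσ0 f hf h.1 h.2)
    have hfW : ∀ w ∈ f, w ∈ W := by
      rcases hmeet with h | h
      · exact hW f hf u h hu
      · exact hW f hf v h hv
    have hcard : (∃ w ∈ f, w ∉ c ∧ w ≠ u ∧ w ≠ v) →
        (1 : ℝ) ≤ (W0.filter fun w => w ∉ c ∧ w ∈ f).card := by
      rintro ⟨w, hwf, hwc, hwu, hwv⟩
      have : 0 < (W0.filter fun w => w ∉ c ∧ w ∈ f).card :=
        Finset.card_pos.2 ⟨w, Finset.mem_filter.2 ⟨Finset.mem_erase.2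
          ⟨hwv, Finset.mem_erase.2 ⟨hwu, hfW w hwf⟩⟩, hwc, hwf⟩⟩
      exact_mod_cast this
    have hcard0 : (0 : ℝ) ≤ (W0.filter fun w => w ∉ c ∧ w ∈ f).card := Nat.cast_nonneg _
    rw [if_pos hfW, if_pos hfW]
    by_cases hm : Misses f c
    · have hnot : ¬ (u ∈ c ∧ v ∈ c ∧ ∃ w ∈ f, w ∉ c) := by
        rintro ⟨huc, hvc, -⟩
        rcases hmeet with h | h
        · exact hm u h huc
        · exact hm v h hvc
      rw [if_pos hm, if_pos hm, if_neg hnot]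
      have hc1 := hcard (by
        rcases hmeet with ⟨p, rfl⟩ | ⟨p, rfl⟩
        · refine ⟨p, Sym2.mem_mk_right _ _, hm p (Sym2.mem_mk_right _ _),
            (hloop _ hf u p rfl).symm, ?_⟩
          rintro rfl; exact he hf
        · refine ⟨p, Sym2.mem_mk_right _ _, hm p (Sym2.mem_mk_right _ _), ?_,
            (hloop _ hf v p rfl).symm⟩
          rintro rfl; exact he (by rwa [hedef, Sym2.eq_swap]))
      have := bonus_sub_le (t := x f) hpos.le
      nlinarith
    · rw [if_neg hm, if_neg hm]
      split_ifs with h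
      · obtain ⟨huc, hvc, w, hwf, hwc⟩ := h
        have hc1 := hcard ⟨w, hwf, hwc, fun h => hwc (h ▸ huc), fun h => hwc (h ▸ hvc)⟩
        nlinarith
      · nlinarith
  have hself : edgeCredit x' c e = z + ∑ f ∈ E, σ f +
      if Misses e c then bonus (z + ∑ f ∈ E, σ f) else 0 := by
    rw [edgeCredit, hx', shift_self]
  have hch : ∀ y, vertexCharge (insert e E) x' c y = vertexCharge E x c y +
      if y ∈ c then 0 else cost (level (insert e E) x' y) - cost (level E x y) := by
    intro y
    unfold vertexCharge
    split_ifs <;> ring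
  unfold potential
  rw [hedge, hself, hsplit (vertexCharge E x c), hsplit (vertexCharge (insert e E) x' c), hvert,
    hch u, hch v]
  linarith

theorem disjoint_comp {E : Finset (Sym2 V)} {u v : V} {B : Finset V} (hB : ClosedUnder E B)
    (hu : u ∉ B) (hv : v ∈ B) : Disjoint (comp E u) (comp E v) := by
  rw [Finset.disjoint_left]
  intro w hwu hwv
  have h1 := comp_subset hB hv hwv
  have h2 := comp_subset ((closedUnder_insert_verts E u).sdiff hB)
    (Finset.mem_sdiff.2 ⟨Finset.mem_insert_self _ _, hu⟩) hwu
  exact (Finset.mem_sdiff.1 h2).2 h1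

theorem potential_nonneg {E : Finset (Sym2 V)} {x : Sym2 V → ℝ} (hg : Good E x) {R : Finset V}
    (hR : ClosedUnder E R) {N : Finset (Sym2 V)} (hN : N ⊆ E) (hNm : IsEdgeMatching N) :
    0 ≤ potential E x R (coveredSet N) := by
  by_cases h : ∃ f ∈ E, ∀ w ∈ f, w ∈ R
  · linarith [hg.surplus R hR h N hN hNm]
  · have h' : ∀ w ∈ R, ∀ f ∈ E, w ∉ f := fun w hw f hf hwf => h ⟨f, hf, hR f hf w hwf hw⟩
    rw [potential, Finset.filter_false_of_mem fun f hf hf' => h ⟨f, hf, hf'⟩, Finset.sum_empty,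
      Finset.sum_eq_zero fun w hw => ?_, sub_zero]
    rw [vertexCharge, if_neg, level_eq_zero (h' w hw), cost_of_le (by norm_num)]
    rintro ⟨f, hf, hwf⟩
    exact h' w hw f (hN hf) hwf

theorem surplus_comp {E : Finset (Sym2 V)} {x : Sym2 V → ℝ} (hg : Good E x) (u : V)
    {N : Finset (Sym2 V)} (hN : N ⊆ E) (hNm : IsEdgeMatching N) :
    (if ∃ f ∈ E, u ∈ f then 1 / 4 else 0) ≤ potential E x (comp E u) (coveredSet N) := by
  split_ifs with h
  · obtain ⟨f, hf, hu⟩ := h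
    exact hg.surplus _ (closedUnder_comp E u)
      ⟨f, hf, closedUnder_comp E u f hf u hu (mem_comp_self E u)⟩ N hN hNm
  · exact potential_nonneg hg (closedUnder_comp E u) hN hNm

/-- The invariant is preserved by a step whose total amounts satisfy the local inequalities. -/
theorem good_shift {E : Finset (Sym2 V)} {x : Sym2 V → ℝ} (hg : Good E x) {u v : V}
    (hE : Bridged E) (huv : u ≠ v) (he : s(u, v) ∉ E)
    (hdisj : Disjoint (comp E u) (comp E v)) {su sv : ℝ} {Lu Lv : Sym2 V → ℝ}
    (hub : Hub E x u su Lu) (hvb : Hub E x v sv Lv) {z : ℝ} {σ : Sym2 V → ℝ} (hz : 0 ≤ z)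
    (hσ : ∀ f ∈ E, 0 ≤ σ f) (hσx : ∀ f ∈ E, σ f ≤ x f)
    (hσ0 : ∀ f ∈ E, u ∉ f → v ∉ f → σ f = 0)
    (hσu : ∀ f ∈ E, u ∈ f → σ f ≤ Lu f) (hσv : ∀ f ∈ E, v ∈ f → σ f ≤ Lv f)
    (hfu : ∀ p, s(u, p) ∈ E → 0 < σ s(u, p) → σ s(u, p) + 3 / 8 ≤ level E x p)
    (hfv : ∀ p, s(v, p) ∈ E → 0 < σ s(v, p) → σ s(v, p) + 3 / 8 ≤ level E x p)
    (ht : z + ∑ f ∈ E, σ f ≤ 7 / 8) (hin : 3 / 8 ≤ su + sv + (z + ∑ f ∈ E, σ f))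
    (hlu : level (insert s(u, v) E) (shift E x s(u, v) z σ) u ≤ 1)
    (hlv : level (insert s(u, v) E) (shift E x s(u, v) z σ) v ≤ 1)
    {qu qv du dv : ℝ} (hqu : qu = if ∃ f ∈ E, u ∈ f then 1 / 4 else 0)
    (hqv : qv = if ∃ f ∈ E, v ∈ f then 1 / 4 else 0)
    (hdu : cost (level (insert s(u, v) E) (shift E x s(u, v) z σ) u) - cost (level E x u) = du)
    (hdv : cost (level (insert s(u, v) E) (shift E x s(u, v) z σ) v) - cost (level E x v) = dv)
    (hout : 1 / 4 ≤ qu + qv + z + bonus (z + ∑ f ∈ E, σ f) - du - dv)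
    (hou : (∃ f ∈ E, u ∈ f) → 1 / 4 ≤ qu + qv + z - dv)
    (hov : (∃ f ∈ E, v ∈ f) → 1 / 4 ≤ qu + qv + z - du) :
    Good (insert s(u, v) E) (shift E x s(u, v) z σ) := by
  have hloop : ∀ f ∈ E, ∀ y p, f = s(y, p) → y ≠ p := fun f hf y p h => (hE f hf y p h).1
  have hcu := closedUnder_comp E u
  have hcv := closedUnder_comp E v
  have huCu := mem_comp_self E u
  have hvCv := mem_comp_self E v
  have hvCu : v ∉ comp E u := fun h => (Finset.disjoint_left.1 hdisj h) hvCv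
  have huCv : u ∉ comp E v := fun h => (Finset.disjoint_left.1 hdisj huCu) h
  have hσ0' : 0 ≤ ∑ f ∈ E, σ f := Finset.sum_nonneg hσ
  have hX : ∀ w, w ∉ s(u, v) → ∑ f ∈ E with w ∈ f, σ f = 0 ∨
      3 / 8 ≤ level E x w - ∑ f ∈ E with w ∈ f, σ f := by
    intro w hw
    rw [Sym2.mem_iff, not_or] at hw
    by_cases h : ∃ f ∈ E, w ∈ f ∧ 0 < σ f
    · right
      obtain ⟨f, hf, hwf, hpos⟩ := h
      -- Only one edge at w loses weight: such edges meet u or v, and w cannot lie in both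
      -- components.
      have huniq : ∀ y y', (y = u ∧ y' = v) ∨ (y = v ∧ y' = u) → f = s(y, w) →
          ∑ g ∈ E with w ∈ g, σ g = σ f := by
        intro y y' hy hfe
        refine Finset.sum_eq_single_of_mem f (Finset.mem_filter.2 ⟨hf, hwf⟩) fun g hgm hne => ?_
        obtain ⟨hgE, hwg⟩ := Finset.mem_filter.1 hgm
        have hyg : y ∉ g := by
          intro hyg
          apply hne
          rw [hfe]
          refine (Sym2.mem_and_mem_iff ?_).1 ⟨hyg, hwg⟩
          rcases hy with ⟨rfl, rfl⟩ | ⟨rfl, rfl⟩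
          · exact fun h => hw.1 h.symm
          · exact fun h => hw.2 h.symm
        have hy'g : y' ∉ g := by
          intro hy'g
          rcases hy with ⟨rfl, rfl⟩ | ⟨rfl, rfl⟩
          · exact Finset.disjoint_left.1 hdisj
              (hcu f hf y (hfe ▸ Sym2.mem_mk_left _ _) huCu w hwf) (hcv g hgE y' hy'g hvCv w hwg)
          · exact Finset.disjoint_left.1 hdisj (hcu g hgE y' hy'g huCu w hwg)
              (hcv f hf y (hfe ▸ Sym2.mem_mk_left _ _) hvCv w hwf)
        rcases hy with ⟨rfl, rfl⟩ | ⟨rfl, rfl⟩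
        · exact hσ0 g hgE hyg hy'g
        · exact hσ0 g hgE hy'g hyg
      by_cases hu : u ∈ f
      · have hfe : f = s(u, w) := (Sym2.mem_and_mem_iff (fun h => hw.1 h.symm)).1 ⟨hu, hwf⟩
        rw [huniq u v (Or.inl ⟨rfl, rfl⟩) hfe]
        subst hfe
        linarith [hfu w hf hpos]
      by_cases hv : v ∈ f
      · have hfe : f = s(v, w) := (Sym2.mem_and_mem_iff (fun h => hw.2 h.symm)).1 ⟨hv, hwf⟩
        rw [huniq v u (Or.inr ⟨rfl, rfl⟩) hfe]
        subst hfe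
        linarith [hfv w hf hpos]
      exact absurd (hσ0 f hf hu hv) hpos.ne'
    · left
      push Not at h
      refine Finset.sum_eq_zero fun f hf => ?_
      obtain ⟨hf, hwf⟩ := Finset.mem_filter.1 hf
      exact le_antisymm (h f hf hwf) (hσ f hf)
  refine ⟨?_, ?_, ?_, ?_⟩
  · intro f hf
    rcases Finset.mem_insert.1 hf with rfl | hf
    · rw [shift_self]; linarith
    · rw [shift_of_mem he hf]; linarith [hσx f hf]
  · intro f hf
    rcases Finset.mem_insert.1 hf with rfl | hf
    · rw [shift_self]; linarith
    · rw [shift_of_mem he hf]; linarith [hσ f hf, hg.le_cap f hf]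
  · intro w
    by_cases hw : w ∈ s(u, v)
    · rcases Sym2.mem_iff.1 hw with rfl | rfl <;> assumption
    · rw [level_shift_of_notMem he hw]
      have : 0 ≤ ∑ f ∈ E with w ∈ f, σ f :=
        Finset.sum_nonneg fun f hf => hσ f (Finset.mem_filter.1 hf).1
      linarith [hg.level_le w]
  · intro W hW hWe N' hN' hNm'
    have hWE : ClosedUnder E W := hW.mono (Finset.subset_insert _ _)
    have hNE : N'.erase s(u, v) ⊆ E := by
      intro f hf
      rw [Finset.mem_erase] at hf
      exact (Finset.mem_insert.1 (hN' hf.2)).resolve_left hf.1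
    by_cases huW : u ∈ W
    · have hvW : v ∈ W := hW _ (Finset.mem_insert_self _ _) u (Sym2.mem_mk_left _ _) huW v
        (Sym2.mem_mk_right _ _)
      have hdelta := le_potential_shift (z := z) hloop huv he hσ hσ0 hX hWE huW hvW (coveredSet N')
      have hsub : comp E v ⊆ W \ comp E u := by
        intro w hw
        exact Finset.mem_sdiff.2 ⟨comp_subset hWE hvW hw, Finset.disjoint_right.1 hdisj hw⟩
      have hdec : ∀ c, potential E x W c = potential E x (comp E u) c + potential E x (comp E v) c +
          potential E x ((W \ comp E u) \ comp E v) c := by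
        intro c
        rw [potential_add c (comp_subset hWE huW) hcu, potential_add c hsub hcv]
        ring
      have hRcl : ClosedUnder E ((W \ comp E u) \ comp E v) := (hWE.sdiff hcu).sdiff hcv
      rw [hdec] at hdelta
      by_cases heN : s(u, v) ∈ N'
      -- The comparison matching uses the new edge: what is left avoids u and v, so both hub bounds
      -- apply. The two offsets 1/16 turn the target 1/4 into 3/8.
      · set N := N'.erase s(u, v) with hNdef
        have hNm : IsEdgeMatching N := hNm'.subset (Finset.erase_subset _ _)
        have hNu : ∀ g ∈ N, u ∉ g := by
          intro g hgN hug
          rw [hNdef, Finset.mem_erase] at hgN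
          exact hgN.1 (hNm' g hgN.2 _ heN u hug (Sym2.mem_mk_left _ _))
        have hNv : ∀ g ∈ N, v ∉ g := by
          intro g hgN hvg
          rw [hNdef, Finset.mem_erase] at hgN
          exact hgN.1 (hNm' g hgN.2 _ heN v hvg (Sym2.mem_mk_right _ _))
        have hcov : coveredSet N' = insert v (insert u (coveredSet N)) := by
          rw [← coveredSet_insert_mk, hNdef, Finset.insert_erase heN]
        have huc : u ∈ coveredSet N' := by rw [hcov]; simp
        have hvc : v ∈ coveredSet N' := by rw [hcov]; simp
        have hmiss : ¬ Misses s(u, v) (coveredSet N') := fun h => (misses_mk_iff.1 h).1 huc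
        have e1 : potential E x (comp E u) (coveredSet N') =
            potential E x (comp E u) (insert u (coveredSet N)) := by
          refine potential_congr fun w hw => ?_
          rw [hcov, Set.mem_insert_iff, or_iff_right]
          rintro rfl; exact hvCu hw
        have e2 : potential E x (comp E v) (coveredSet N') =
            potential E x (comp E v) (insert v (coveredSet N)) := by
          refine potential_congr fun w hw => ?_
          rw [hcov, Set.mem_insert_iff, Set.mem_insert_iff, Set.mem_insert_iff, or_iff_right (a := w = u)]
          rintro rfl; exact huCv hw
        have e3 : potential E x ((W \ comp E u) \ comp E v) (coveredSet N') =
            potential E x ((W \ comp E u) \ comp E v) (coveredSet N) := by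
          refine potential_congr fun w hw => ?_
          rw [Finset.mem_sdiff, Finset.mem_sdiff] at hw
          rw [hcov, Set.mem_insert_iff, Set.mem_insert_iff, or_iff_right, or_iff_right]
          · rintro rfl; exact hw.1.2 huCu
          · rintro rfl; exact hw.2 hvCv
        have h1 := hub.lower N hNE hNm hNu
        have h2 := hvb.lower N hNE hNm hNv
        have h3 := potential_nonneg hg hRcl hNE hNm
        -- Each σ f is paid by its load if the far end is covered, and by the falling charge of the
        -- far end otherwise.
        have h4 : ∑ f ∈ E, σ f ≤ ∑ f ∈ E with u ∈ f ∧ ¬ Misses f (coveredSet N), Lu f +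
            ∑ f ∈ E with v ∈ f ∧ ¬ Misses f (coveredSet N), Lv f +
            ∑ f ∈ E, if u ∈ coveredSet N' ∧ v ∈ coveredSet N' ∧ ∃ w ∈ f, w ∉ coveredSet N'
              then σ f else 0 := by
          simp only [Finset.sum_filter]
          rw [← Finset.sum_add_distrib, ← Finset.sum_add_distrib]
          refine Finset.sum_le_sum fun f hf => ?_
          have n1 : 0 ≤ if u ∈ f ∧ ¬ Misses f (coveredSet N) then Lu f else 0 := by
            split_ifs with h
            · exact hub.load_nonneg f hf h.1
            · exact le_rfl
          have n2 : 0 ≤ if v ∈ f ∧ ¬ Misses f (coveredSet N) then Lv f else 0 := by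
            split_ifs with h
            · exact hvb.load_nonneg f hf h.1
            · exact le_rfl
          have n3 : 0 ≤ if u ∈ coveredSet N' ∧ v ∈ coveredSet N' ∧ ∃ w ∈ f, w ∉ coveredSet N'
              then σ f else 0 := by
            split_ifs
            · exact hσ f hf
            · exact le_rfl
          by_cases hu : u ∈ f
          · by_cases hm : Misses f (coveredSet N)
            · obtain ⟨p, rfl⟩ := hu
              rw [if_pos (c := _ ∧ _ ∧ _)]
              · linarith
              refine ⟨huc, hvc, p, Sym2.mem_mk_right _ _, ?_⟩
              rw [hcov, Set.mem_insert_iff, Set.mem_insert_iff, not_or, not_or]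
              refine ⟨?_, (hloop _ hf u p rfl).symm, (misses_mk_iff.1 hm).2⟩
              rintro rfl; exact he hf
            · rw [if_pos ⟨hu, hm⟩]
              linarith [hσu f hf hu]
          by_cases hv : v ∈ f
          · by_cases hm : Misses f (coveredSet N)
            · obtain ⟨p, rfl⟩ := hv
              rw [if_pos (c := _ ∧ _ ∧ _)]
              · linarith
              refine ⟨huc, hvc, p, Sym2.mem_mk_right _ _, ?_⟩
              rw [hcov, Set.mem_insert_iff, Set.mem_insert_iff, not_or, not_or]
              refine ⟨(hloop _ hf v p rfl).symm, ?_, (misses_mk_iff.1 hm).2⟩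
              rintro rfl; exact he (by rwa [Sym2.eq_swap])
            · rw [if_pos (c := v ∈ f ∧ _) ⟨hv, hm⟩]
              linarith [hσv f hf hv]
          rw [hσ0 f hf hu hv] at n3 ⊢
          linarith
        rw [if_neg hmiss, if_pos huc, if_pos hvc, e1, e2, e3] at hdelta
        linarith
      · have hNE' : N' ⊆ E := by rwa [Finset.erase_eq_of_notMem heN] at hNE
        have h1 := surplus_comp hg u hNE' hNm'
        have h2 := surplus_comp hg v hNE' hNm'
        have h3 := potential_nonneg hg hRcl hNE' hNm'
        rw [← hqu] at h1
        rw [← hqv] at h2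
        have h4 : 0 ≤ ∑ f ∈ E, if u ∈ coveredSet N' ∧ v ∈ coveredSet N' ∧
            ∃ w ∈ f, w ∉ coveredSet N' then σ f else 0 := by
          refine Finset.sum_nonneg fun f hf => ?_
          split_ifs
          · exact hσ f hf
          · exact le_rfl
        have hex : ∀ y, y ∈ coveredSet N' → ∃ f ∈ E, y ∈ f := by
          rintro y ⟨f, hf, hy⟩
          exact ⟨f, hNE' hf, hy⟩
        rw [hdu, hdv] at hdelta
        -- Without the new edge the old surpluses add up; only an uncovered end pays for its higher
        -- level, and the new bonus counts only when both ends are uncovered.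
        by_cases huc : u ∈ coveredSet N' <;> by_cases hvc : v ∈ coveredSet N'
        · have hmiss : ¬ Misses s(u, v) (coveredSet N') := fun h => (misses_mk_iff.1 h).1 huc
          rw [if_neg hmiss, if_pos huc, if_pos hvc] at hdelta
          rw [if_pos (hex u huc)] at hqu
          rw [if_pos (hex v hvc)] at hqv
          linarith
        · have hmiss : ¬ Misses s(u, v) (coveredSet N') := fun h => (misses_mk_iff.1 h).1 huc
          rw [if_neg hmiss, if_pos huc, if_neg hvc] at hdelta
          linarith [hou (hex u huc)]
        · have hmiss : ¬ Misses s(u, v) (coveredSet N') := fun h => (misses_mk_iff.1 h).2 hvc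
          rw [if_neg hmiss, if_neg huc, if_pos hvc] at hdelta
          linarith [hov (hex v hvc)]
        · rw [if_pos (misses_mk_iff.2 ⟨huc, hvc⟩), if_neg huc, if_neg hvc] at hdelta
          linarith
    · have hvW : v ∉ W := fun hv => huW (hW _ (Finset.mem_insert_self _ _) v
        (Sym2.mem_mk_right _ _) hv u (Sym2.mem_mk_left _ _))
      -- A union of components away from u and v is not affected by the step.
      have hzero : ∀ f ∈ E, (∃ w ∈ f, w ∈ W) → σ f = 0 := by
        rintro f hf ⟨w, hwf, hwW⟩
        have := hWE f hf w hwf hwW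
        exact hσ0 f hf (fun h => huW (this u h)) (fun h => hvW (this v h))
      have hnoe : ¬ ∀ w ∈ s(u, v), w ∈ W := fun h => huW (h u (Sym2.mem_mk_left _ _))
      have e1 : potential (insert s(u, v) E) (shift E x s(u, v) z σ) W (coveredSet N') =
          potential E x W (coveredSet (N'.erase s(u, v))) := by
        have : potential E x W (coveredSet (N'.erase s(u, v))) =
            potential E x W (coveredSet N') := by
          refine potential_congr fun w hw => ⟨?_, ?_⟩
          · rintro ⟨f, hf, hwf⟩
            exact ⟨f, Finset.mem_of_mem_erase hf, hwf⟩
          · rintro ⟨f, hf, hwf⟩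
            refine ⟨f, Finset.mem_erase.2 ⟨?_, hf⟩, hwf⟩
            rintro rfl
            rcases Sym2.mem_iff.1 hwf with rfl | rfl
            · exact huW hw
            · exact hvW hw
        rw [this, potential, potential, Finset.filter_insert, if_neg hnoe]
        congr 1
        · refine Finset.sum_congr rfl fun f hf => ?_
          obtain ⟨hf, hfW⟩ := Finset.mem_filter.1 hf
          have h0 : σ f = 0 := by
            refine hσ0 f hf (fun h => huW (hfW u h)) (fun h => hvW (hfW v h))
          rw [edgeCredit, edgeCredit, shift_of_mem he hf, h0, sub_zero]
        · refine Finset.sum_congr rfl fun w hw => ?_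
          have hwe : w ∉ s(u, v) := by
            intro h
            rcases Sym2.mem_iff.1 h with rfl | rfl
            · exact huW hw
            · exact hvW hw
          rw [vertexCharge, vertexCharge, level_shift_of_notMem he hwe,
            Finset.sum_eq_zero fun f hf => ?_, sub_zero]
          obtain ⟨hf, hwf⟩ := Finset.mem_filter.1 hf
          exact hzero f hf ⟨w, hwf, hw⟩
      rw [e1]
      refine hg.surplus W hWE ?_ _ hNE (hNm'.subset (Finset.erase_subset _ _))
      obtain ⟨f, hf, hfW⟩ := hWe
      rcases Finset.mem_insert.1 hf with rfl | hf
      · exact absurd hfW hnoe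
      · exact ⟨f, hf, hfW⟩

end Shift

/-! ### Real inequalities: how much an arriving edge can obtain. -/

section Amounts

/-- At levels up to 1/2 the costs are at most 1/8, so truncation at 1/4 is harmless and the claim
reduces to (1-a)(1-b) + cost a + cost b ≥ 3/8. -/
theorem capacity_low_low {a b su sv Lu Lv : ℝ} (ha : a ≤ 1 / 2)
    (hb : b ≤ 1 / 2) (hsu : 0 ≤ su) (hsv : 0 ≤ sv)
    (hcu : cost a ≤ su + Lu) (hcv : cost b ≤ sv + Lv) :
    3 / 8 ≤ (1 - a) * (1 - b) + min (1 / 4) Lu + min (1 / 4) Lv + su + sv := by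
  have key : ∀ {t s L : ℝ}, t ≤ 1 / 2 → 0 ≤ s → cost t ≤ s + L → cost t ≤ min (1 / 4) L + s := by
    intro t s L ht hs hc
    rcases le_total (1 / 4) L with h | h
    · rw [min_eq_left h]
      have : cost t ≤ 1 / 8 := max_le (by norm_num) (by linarith)
      linarith
    · rw [min_eq_right h]; linarith
  have h1 := key ha hsu hcu
  have h2 := key hb hsv hcv
  have h3 := cost_nonneg a
  have h4 := cost_nonneg b
  have h5 := le_cost a
  have h6 := le_cost b
  rcases le_total a (3 / 8) with h | h <;> rcases le_total b (3 / 8) with h' | h' <;> nlinarith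

/-- The free amount and the v side give at least 5/8 · (1-a). The u side gives at least min(1/4, a -
3/8), and also a - 1/2 because its load is at most 3/8; the breakpoints are a = 5/8 and a = 3/4. -/
theorem capacity_high_low {a b su sv Lu Lv : ℝ} (ha : 1 / 2 ≤ a) (ha1 : a ≤ 1)
    (hb : b ≤ 1 / 2) (hLu1 : Lu ≤ 3 / 8) (hLv : 0 ≤ Lv) (hsu : 0 ≤ su) (hsv : 0 ≤ sv)
    (hcu : cost a ≤ su + Lu) (hcv : cost b ≤ sv + Lv) :
    3 / 8 ≤ (1 - a) * (1 - b) + min (1 / 4) Lu + min (1 / 4) (Lv * (2 * (1 - a))) + su + sv := by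
  have hca := le_cost a
  have h5 := le_cost b
  have hu1 : min (1 / 4) (a - 3 / 8) ≤ min (1 / 4) Lu + su := by
    rcases le_total (1 / 4) Lu with h | h
    · rw [min_eq_left h]; linarith [min_le_left (1 / 4) (a - 3 / 8)]
    · rw [min_eq_right h]; linarith [min_le_right (1 / 4) (a - 3 / 8)]
  have hu2 : a - 1 / 2 ≤ min (1 / 4) Lu + su := by
    rcases le_total (1 / 4) Lu with h | h
    · rw [min_eq_left h]; linarith
    · rw [min_eq_right h]; linarith
  have hv : 5 / 8 * (1 - a) ≤
      (1 - a) * (1 - b) + min (1 / 4) (Lv * (2 * (1 - a))) + sv := by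
    have h0 : 0 ≤ Lv * (2 * (1 - a)) := mul_nonneg hLv (by linarith)
    rcases le_total (1 / 4) (Lv * (2 * (1 - a))) with h | h
    · rw [min_eq_left h]; nlinarith
    · rw [min_eq_right h]
      nlinarith [mul_nonneg (sub_nonneg.2 ha1) (show 0 ≤ sv + Lv - (b - 3 / 8) by linarith),
        mul_nonneg (sub_nonneg.2 ha1) hLv, mul_nonneg hsv (show 0 ≤ a by linarith)]
  rcases le_total a (5 / 8) with h | h
  · rw [min_eq_right (by linarith)] at hu1; linarith
  · rw [min_eq_left (by linarith)] at hu1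
    rcases le_total a (3 / 4) with h' | h' <;> linarith

/-- Here p and q stand for one minus the levels. As 2q ≤ 1, trading s for load only loses, so the
worst case is the largest load L = 3/8. -/
theorem load_of_low {p q s L : ℝ} (hq : q ≤ 1 / 2)
    (hL1 : L ≤ 3 / 8) (hc : 5 / 8 - p ≤ s + L) :
    min (1 / 4 + (1 / 4 - p)) (3 * q / 4 + 1 / 4 - p) ≤ min (1 / 4) (L * (2 * q)) + s := by
  rcases le_total (1 / 4) (L * (2 * q)) with h | h
  · rw [min_eq_left h]
    exact (min_le_left _ _).trans (by linarith)
  · rw [min_eq_right h]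
    refine (min_le_right _ _).trans ?_
    nlinarith [mul_nonneg (sub_nonneg.2 hL1) (show 0 ≤ 1 - 2 * q by linarith)]

/-- The same trade-off limited by s ≥ 0: the worst case is s = 0 and L = 5/8 - p. -/
theorem load_of_high {p q s L : ℝ} (hq : q ≤ 1 / 2) (hq0 : 0 ≤ q) (hs : 0 ≤ s)
    (hc : 5 / 8 - p ≤ s + L) :
    min (1 / 4) (2 * q * (5 / 8 - p)) ≤ min (1 / 4) (L * (2 * q)) + s := by
  rcases le_total (1 / 4) (L * (2 * q)) with h | h
  · rw [min_eq_left h]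
    exact (min_le_left _ _).trans (by linarith)
  · rw [min_eq_right h]
    refine (min_le_right _ _).trans ?_
    nlinarith [mul_nonneg hq0 (show 0 ≤ s + L - (5 / 8 - p) by linarith),
      mul_nonneg hs (show 0 ≤ 1 - 2 * q by linarith)]

theorem capacity_mixed {p q su sv Lu Lv : ℝ} (hp : p ≤ 1 / 2) (hq0 : 0 ≤ q)
    (hp4 : 1 / 4 ≤ p) (hq4 : q ≤ 1 / 4) (hLv1 : Lv ≤ 3 / 8) (hsu : 0 ≤ su)
    (hcu : 5 / 8 - p ≤ su + Lu) (hcv : 5 / 8 - q ≤ sv + Lv) :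
    3 / 8 ≤ p * q + min (1 / 4) (Lu * (2 * q)) + min (1 / 4) (Lv * (2 * p)) + su + sv := by
  have h1 := load_of_high (p := p) (q := q) (by linarith) hq0 hsu hcu
  have h2 := load_of_low (p := q) (q := p) hp hLv1 hcv
  have h3 : 2 * q * (5 / 8 - p) ≤ 1 / 4 := by nlinarith
  rw [min_eq_right h3] at h1
  rcases min_choice (1 / 4 + (1 / 4 - q)) (3 * p / 4 + 1 / 4 - q) with h | h <;>
    rw [h] at h2 <;> nlinarith

theorem capacity_high_high {p q su sv Lu Lv : ℝ} (hp : p ≤ 1 / 2) (hq : q ≤ 1 / 2) (hp0 : 0 ≤ p)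
    (hq0 : 0 ≤ q) (hLu1 : Lu ≤ 3 / 8) (hLv1 : Lv ≤ 3 / 8) (hsu : 0 ≤ su)
    (hsv : 0 ≤ sv) (hcu : 5 / 8 - p ≤ su + Lu) (hcv : 5 / 8 - q ≤ sv + Lv) :
    3 / 8 ≤ p * q + min (1 / 4) (Lu * (2 * q)) + min (1 / 4) (Lv * (2 * p)) + su + sv := by
  rcases le_total p (1 / 4) with hp4 | hp4 <;> rcases le_total q (1 / 4) with hq4 | hq4
  · have h1 := load_of_low hq hLu1 hcu
    have h2 := load_of_low hp hLv1 hcv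
    rw [min_eq_right (by linarith)] at h1 h2
    nlinarith [mul_nonneg hp0 hq0]
  · have := capacity_mixed hq hp0 hq4 hp4 hLu1 hsv hcv hcu
    linarith [mul_comm p q]
  · exact capacity_mixed hp hq0 hp4 hq4 hLv1 hsu hcu hcv
  · have h1 := load_of_high (p := p) hq hq0 hsu hcu
    have h2 := load_of_high (p := q) hp hp0 hsv hcv
    rcases min_choice (1 / 4) (2 * q * (5 / 8 - p)) with h | h <;>
    rcases min_choice (1 / 4) (2 * p * (5 / 8 - q)) with h' | h' <;>
    rw [h] at h1 <;> rw [h'] at h2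
    · linarith [mul_nonneg hp0 hq0]
    · nlinarith
    · nlinarith
    · nlinarith [mul_nonneg (sub_nonneg.2 hp) (sub_nonneg.2 hq4),
        mul_nonneg (sub_nonneg.2 hp4) (sub_nonneg.2 hq), mul_nonneg (sub_nonneg.2 hp) (sub_nonneg.2 hq),
        mul_nonneg (sub_nonneg.2 hp4) (sub_nonneg.2 hq4)]

/-- A merging edge can reach s_u + s_v + t = 3/8 unless s_u + s_v is already larger. `Mu` and `Mv`
are what loads and probabilities jointly allow; truncation at 1/4 keeps the matchings that cover
just one of u and v safe. -/
theorem merge_capacity {a b su sv Lu Lv Mu Mv : ℝ} (ha1 : a ≤ 1) (hb1 : b ≤ 1) (hLu : 0 ≤ Lu) (hLu1 : Lu ≤ 3 / 8) (hLv : 0 ≤ Lv) (hLv1 : Lv ≤ 3 / 8)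
    (hsu : 0 ≤ su) (hsv : 0 ≤ sv) (hcu : cost a ≤ su + Lu) (hcv : cost b ≤ sv + Lv)
    (hMu : Lu * min 1 (2 * (1 - b)) ≤ Mu) (hMv : Lv * min 1 (2 * (1 - a)) ≤ Mv) :
    3 / 8 ≤ (1 - a) * (1 - b) + min (1 / 4) Mu + min (1 / 4) Mv + su + sv := by
  have hu := min_le_min_left (1 / 4) hMu
  have hv := min_le_min_left (1 / 4) hMv
  rcases le_total a (1 / 2) with ha | ha <;> rcases le_total b (1 / 2) with hb | hb
  · rw [min_eq_left (a := 1) (by linarith), mul_one] at hu hv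
    linarith [capacity_low_low ha hb hsu hsv hcu hcv]
  · rw [min_eq_left (a := 1) (by linarith), mul_one] at hv
    rw [min_eq_right (a := 1) (by linarith)] at hu
    linarith [capacity_high_low hb hb1 ha hLv1 hLu hsv hsu hcv hcu, mul_comm (1 - a) (1 - b)]
  · rw [min_eq_left (a := 1) (by linarith), mul_one] at hu
    rw [min_eq_right (a := 1) (by linarith)] at hv
    linarith [capacity_high_low ha ha1 hb hLu1 hLv hsu hsv hcu hcv]
  · rw [min_eq_right (a := 1) (by linarith)] at hu hv
    have := capacity_high_high (p := 1 - a) (q := 1 - b) (by linarith) (by linarith) (by linarith)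
      (by linarith) hLu1 hLv1 hsu hsv (by linarith [le_cost a]) (by linarith [le_cost b])
    linarith

/-- The amounts with which a merging edge enters: `z` for free, `A` and `B` from the two sides. -/
theorem exists_merge_amounts {a b su sv Mu Mv : ℝ} (ha1 : a ≤ 1) (hb1 : b ≤ 1) (hMu : 0 ≤ Mu)
    (hMv : 0 ≤ Mv) (hsu : 0 ≤ su) (hsv : 0 ≤ sv)
    (h : 3 / 8 ≤ (1 - a) * (1 - b) + min (1 / 4) Mu + min (1 / 4) Mv + su + sv) :
    ∃ z A B : ℝ, 0 ≤ z ∧ 0 ≤ A ∧ 0 ≤ B ∧ z ≤ (1 - a) * (1 - b) ∧ A ≤ Mu ∧ B ≤ Mv ∧ A ≤ 1 / 4 ∧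
      B ≤ 1 / 4 ∧ z + A + B ≤ 3 / 8 ∧ 3 / 8 ≤ su + sv + (z + A + B) ∧
      (0 < z + A + B → su + sv + (z + A + B) ≤ 3 / 8) := by
  have hz : 0 ≤ (1 - a) * (1 - b) := mul_nonneg (by linarith) (by linarith)
  have hA : 0 ≤ min (1 / 4) Mu := le_min (by norm_num) hMu
  have hB : 0 ≤ min (1 / 4) Mv := le_min (by norm_num) hMv
  have hA1 := min_le_left (1 / 4) Mu
  have hA2 := min_le_right (1 / 4) Mu
  have hB1 := min_le_left (1 / 4) Mv
  have hB2 := min_le_right (1 / 4) Mv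
  generalize min (1 / 4) Mu = P at *
  generalize min (1 / 4) Mv = Q at *
  generalize (1 - a) * (1 - b) = Z at *
  -- Greedy choice: first the free amount, then the u side, then the v side, stopping exactly at
  -- 3/8. Not overshooting is needed for the far ends.
  by_cases h0 : 3 / 8 ≤ su + sv
  · exact ⟨0, 0, 0, by norm_num, by norm_num, by norm_num, hz, hMu, hMv, by norm_num, by norm_num,
      by norm_num, by linarith, by norm_num⟩
  push Not at h0
  by_cases h1 : 3 / 8 ≤ su + sv + Z
  · exact ⟨3 / 8 - su - sv, 0, 0, by linarith, by norm_num, by norm_num, by linarith, hMu, hMv,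
      by norm_num, by norm_num, by linarith, by linarith, by intro; linarith⟩
  push Not at h1
  by_cases h2 : 3 / 8 ≤ su + sv + Z + P
  · exact ⟨Z, 3 / 8 - su - sv - Z, 0, hz, by linarith, by norm_num, le_rfl, by linarith, hMv,
      by linarith, by norm_num, by linarith, by linarith, by intro; linarith⟩
  push Not at h2
  exact ⟨Z, P, 3 / 8 - su - sv - Z - P, hz, hA, by linarith, le_rfl, hA2, by linarith, hA1,
    by linarith, by linarith, by linarith, by intro; linarith⟩

/-- The amounts with which a new leaf enters. -/
theorem exists_leaf_amounts {a s L : ℝ} (ha1 : a ≤ 1) (hL : 0 ≤ L) (hL1 : L ≤ 3 / 8) (hs : 0 ≤ s)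
    (hc : cost a ≤ s + L) :
    ∃ z A : ℝ, 0 ≤ z ∧ 0 ≤ A ∧ z ≤ 1 - a ∧ A ≤ L ∧ A ≤ 3 / 8 ∧ z + A ≤ 5 / 8 ∧
      5 / 8 ≤ s + (z + A) ∧ (0 < z + A → s + (z + A) ≤ 5 / 8) := by
  have := le_cost a
  by_cases h0 : 5 / 8 ≤ s
  · exact ⟨0, 0, by norm_num, by norm_num, by linarith, hL, by norm_num, by norm_num, by linarith,
      by norm_num⟩
  push Not at h0
  by_cases h1 : 5 / 8 - s ≤ 1 - a
  · exact ⟨5 / 8 - s, 0, by linarith, by norm_num, h1, hL, by norm_num, by linarith, by linarith,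
      by intro; linarith⟩
  push Not at h1
  -- After the free amount 1 - a, exactly (a - 3/8) - s is missing, and the cost bound says that the
  -- load covers it.
  exact ⟨1 - a, 5 / 8 - s - (1 - a), by linarith, by linarith, le_rfl, by linarith, by linarith,
    by linarith, by linarith, by intro; linarith⟩

/-- An amount below a sum of capacities can be distributed. -/
theorem exists_distribution {ι : Type*} (I : Finset ι) (m : ι → ℝ) (hm : ∀ i ∈ I, 0 ≤ m i) {A : ℝ}
    (hA : 0 ≤ A) (hAm : A ≤ ∑ i ∈ I, m i) :
    ∃ σ : ι → ℝ, (∀ i ∈ I, 0 ≤ σ i ∧ σ i ≤ m i) ∧ ∑ i ∈ I, σ i = A := by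
  rcases (Finset.sum_nonneg hm).eq_or_lt with h | h
  · refine ⟨0, fun i hi => ⟨le_rfl, hm i hi⟩, ?_⟩
    simp; linarith
  · refine ⟨fun i => A / (∑ j ∈ I, m j) * m i, fun i hi => ⟨by have := hm i hi; positivity, ?_⟩, ?_⟩
    · exact mul_le_of_le_one_left (hm i hi) ((div_le_one h).2 hAm)
    · rw [← Finset.mul_sum, div_mul_cancel₀ _ h.ne']

end Amounts

/-! ### Existence of a step for each kind of arrival. -/

section Step

open Classical

variable {V : Type*}

theorem Bridged.mono {E E' : Finset (Sym2 V)} (h : Bridged E') (hE : E ⊆ E') : Bridged E := by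
  intro f hf u p hfe
  obtain ⟨h1, B, h2, h3, h4⟩ := h f (hE hf) u p hfe
  exact ⟨h1, B, h2, h3, h4.mono (Finset.erase_subset_erase _ hE)⟩

theorem add_le_of_le_cost {r t : ℝ} (hr : 0 < r) (h : r ≤ cost t) : r + 3 / 8 ≤ t := by
  rcases le_total t (3 / 8) with ht | ht
  · rw [cost_of_le ht] at h; linarith
  · rw [cost_of_ge ht] at h; linarith

/-- The amounts taken over from the edges at `u` and at `v`, edge by edge. -/
theorem exists_shares {E : Finset (Sym2 V)} {u v : V} (huv : u ≠ v) (he : s(u, v) ∉ E)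
    {mu mv : Sym2 V → ℝ} (hmu : ∀ f ∈ E, u ∈ f → 0 ≤ mu f) (hmv : ∀ f ∈ E, v ∈ f → 0 ≤ mv f)
    {A B : ℝ} (hA : 0 ≤ A) (hB : 0 ≤ B) (hAm : A ≤ ∑ f ∈ E with u ∈ f, mu f)
    (hBm : B ≤ ∑ f ∈ E with v ∈ f, mv f) :
    ∃ σ : Sym2 V → ℝ, (∀ f ∈ E, u ∈ f → 0 ≤ σ f ∧ σ f ≤ mu f) ∧
      (∀ f ∈ E, v ∈ f → 0 ≤ σ f ∧ σ f ≤ mv f) ∧ (∀ f ∈ E, u ∉ f → v ∉ f → σ f = 0) ∧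
      (∑ f ∈ E with u ∈ f, σ f = A) ∧ (∑ f ∈ E with u ∉ f, σ f = B) ∧
      (∑ f ∈ E with v ∈ f, σ f = B) ∧ (∑ f ∈ E with v ∉ f, σ f = A) ∧ ∑ f ∈ E, σ f = A + B := by
  obtain ⟨α, hα, hαA⟩ := exists_distribution (E.filter (u ∈ ·)) mu
    (fun f hf => hmu f (Finset.mem_filter.1 hf).1 (Finset.mem_filter.1 hf).2) hA hAm
  obtain ⟨β, hβ, hβB⟩ := exists_distribution (E.filter (v ∈ ·)) mv
    (fun f hf => hmv f (Finset.mem_filter.1 hf).1 (Finset.mem_filter.1 hf).2) hB hBm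
  have hnot : ∀ f ∈ E, v ∈ f → u ∉ f := fun f hf hv hu =>
    he (((Sym2.mem_and_mem_iff huv).1 ⟨hu, hv⟩) ▸ hf)
  let σ : Sym2 V → ℝ := fun f => if u ∈ f then α f else if v ∈ f then β f else 0
  have h1 : ∑ f ∈ E with u ∈ f, σ f = A := by
    rw [← hαA]
    exact Finset.sum_congr rfl fun f hf => if_pos (Finset.mem_filter.1 hf).2
  have h2 : ∑ f ∈ E with v ∈ f, σ f = B := by
    rw [← hβB]
    refine Finset.sum_congr rfl fun f hf => ?_
    obtain ⟨hf, hv⟩ := Finset.mem_filter.1 hf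
    simp only [σ, if_neg (hnot f hf hv), if_pos hv]
  have h3 : ∑ f ∈ E with u ∉ f, σ f = B := by
    rw [← h2, Finset.sum_filter, Finset.sum_filter]
    refine Finset.sum_congr rfl fun f hf => ?_
    by_cases hv : v ∈ f
    · rw [if_pos (hnot f hf hv), if_pos hv]
    · rw [if_neg hv]
      by_cases hu : u ∈ f <;> simp [σ, hu, hv]
  have h4 : ∑ f ∈ E, σ f = A + B := by
    rw [← Finset.sum_filter_add_sum_filter_not E (u ∈ ·), h1, h3]
  refine ⟨σ, ?_, ?_, ?_, h1, h3, h2, ?_, h4⟩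
  · intro f hf hu
    simp only [σ, if_pos hu]
    exact hα f (Finset.mem_filter.2 ⟨hf, hu⟩)
  · intro f hf hv
    simp only [σ, if_neg (hnot f hf hv), if_pos hv]
    exact hβ f (Finset.mem_filter.2 ⟨hf, hv⟩)
  · intro f _ hu hv
    simp [σ, hu, hv]
  · have := Finset.sum_filter_add_sum_filter_not E (v ∈ ·) σ
    rw [h2, h4] at this
    linarith

/-- A step that the randomized algorithm can perform and that preserves the invariant. -/
def IsStep (E : Finset (Sym2 V)) (x : Sym2 V → ℝ) (u v : V) (z : ℝ) (σ : Sym2 V → ℝ) : Prop :=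
  0 ≤ z ∧ z ≤ (1 - level E x u) * (1 - level E x v) ∧
  (∀ f ∈ E, u ∈ f → 0 ≤ σ f ∧ σ f ≤ x f * (1 - level E x v)) ∧
  (∀ f ∈ E, v ∈ f → 0 ≤ σ f ∧ σ f ≤ x f * (1 - level E x u)) ∧
  (∀ f ∈ E, u ∉ f → v ∉ f → σ f = 0) ∧
  Good (insert s(u, v) E) (shift E x s(u, v) z σ)

theorem IsStep.symm {E : Finset (Sym2 V)} {x : Sym2 V → ℝ} {u v : V} {z : ℝ} {σ : Sym2 V → ℝ}
    (h : IsStep E x u v z σ) : IsStep E x v u z σ := by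
  obtain ⟨h1, h2, h3, h4, h5, h6⟩ := h
  rw [Sym2.eq_swap] at h6
  exact ⟨h1, by rwa [mul_comm], h4, h3, fun f hf hv hu => h5 f hf hu hv, h6⟩

/-- Only the totals A and B matter. A single share is at most the weight t of the new edge, and s +
t ≤ 5/8 together with `Hub.far` bounds it by the cost of the far end, so the far end stays at level
at least 3/8. -/
theorem exists_step_of_amounts {E : Finset (Sym2 V)} {x : Sym2 V → ℝ} (hg : Good E x) {u v : V}
    (hE : Bridged (insert s(u, v) E)) (he : s(u, v) ∉ E) {su sv : ℝ} {Lu Lv : Sym2 V → ℝ}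
    (hub : Hub E x u su Lu) (hvb : Hub E x v sv Lv) {z A B : ℝ} (hz : 0 ≤ z) (hA : 0 ≤ A)
    (hB : 0 ≤ B) (hz1 : z ≤ (1 - level E x u) * (1 - level E x v))
    (hA1 : A ≤ ∑ f ∈ E with u ∈ f, min (Lu f) (x f * (1 - level E x v)))
    (hB1 : B ≤ ∑ f ∈ E with v ∈ f, min (Lv f) (x f * (1 - level E x u)))
    (ht : z + A + B ≤ 7 / 8) (hin : 3 / 8 ≤ su + sv + (z + A + B))
    (hAt : 0 < A → su + (z + A + B) ≤ 5 / 8) (hBt : 0 < B → sv + (z + A + B) ≤ 5 / 8)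
    {qu qv du dv : ℝ} (hqu : qu = if ∃ f ∈ E, u ∈ f then 1 / 4 else 0)
    (hqv : qv = if ∃ f ∈ E, v ∈ f then 1 / 4 else 0)
    (hdu : cost (level E x u + z + B) - cost (level E x u) = du)
    (hdv : cost (level E x v + z + A) - cost (level E x v) = dv)
    (hout : 1 / 4 ≤ qu + qv + z + bonus (z + A + B) - du - dv)
    (hou : (∃ f ∈ E, u ∈ f) → 1 / 4 ≤ qu + qv + z - dv)
    (hov : (∃ f ∈ E, v ∈ f) → 1 / 4 ≤ qu + qv + z - du) :
    ∃ z σ, IsStep E x u v z σ := by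
  obtain ⟨huv, D, huD, hvD, hD⟩ := hE _ (Finset.mem_insert_self _ _) u v rfl
  rw [Finset.erase_insert he] at hD
  have ha := hg.level_le u
  have hb := hg.level_le v
  have ha0 := level_nonneg hg.nonneg u
  have hb0 := level_nonneg hg.nonneg v
  obtain ⟨σ, hσu, hσv, hσ0, hsu, hsu', hsv, hsv', hs⟩ := exists_shares huv he
    (mu := fun f => min (Lu f) (x f * (1 - level E x v)))
    (mv := fun f => min (Lv f) (x f * (1 - level E x u)))
    (fun f hf hu => le_min (hub.load_nonneg f hf hu)
      (mul_nonneg (hg.nonneg f hf) (by linarith)))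
    (fun f hf hv => le_min (hvb.load_nonneg f hf hv)
      (mul_nonneg (hg.nonneg f hf) (by linarith))) hA hB hA1 hB1
  have hσ : ∀ f ∈ E, 0 ≤ σ f := by
    intro f hf
    by_cases hu : u ∈ f
    · exact (hσu f hf hu).1
    by_cases hv : v ∈ f
    · exact (hσv f hf hv).1
    exact (hσ0 f hf hu hv).ge
  have hlu : level (insert s(u, v) E) (shift E x s(u, v) z σ) u = level E x u + z + B := by
    rw [level_shift_of_mem he (Sym2.mem_mk_left _ _), hsu']
  have hlv : level (insert s(u, v) E) (shift E x s(u, v) z σ) v = level E x v + z + A := by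
    rw [level_shift_of_mem he (Sym2.mem_mk_right _ _), hsv']
  have hA2 : A ≤ level E x u * (1 - level E x v) := by
    exact hA1.trans (le_of_le_of_eq (Finset.sum_le_sum fun f _ => min_le_right _ _)
      (Finset.sum_mul _ _ _).symm)
  have hB2 : B ≤ level E x v * (1 - level E x u) := by
    exact hB1.trans (le_of_le_of_eq (Finset.sum_le_sum fun f _ => min_le_right _ _)
      (Finset.sum_mul _ _ _).symm)
  have hsum : z + ∑ f ∈ E, σ f = z + A + B := by rw [hs]; ring
  have hσA : ∀ f ∈ E, u ∈ f → σ f ≤ A := by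
    intro f hf hu
    rw [← hsu]
    exact Finset.single_le_sum (f := σ) (fun g hg => hσ g (Finset.mem_filter.1 hg).1)
      (Finset.mem_filter.2 ⟨hf, hu⟩)
  have hσB : ∀ f ∈ E, v ∈ f → σ f ≤ B := by
    intro f hf hv
    rw [← hsv]
    exact Finset.single_le_sum (f := σ) (fun g hg => hσ g (Finset.mem_filter.1 hg).1)
      (Finset.mem_filter.2 ⟨hf, hv⟩)
  have hσx : ∀ f ∈ E, σ f ≤ x f := by
    intro f hf
    have h0 := hg.nonneg f hf
    by_cases hu : u ∈ f
    · exact ((hσu f hf hu).2.trans (min_le_right _ _)).trans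
        (mul_le_of_le_one_right h0 (by linarith))
    by_cases hv : v ∈ f
    · exact ((hσv f hf hv).2.trans (min_le_right _ _)).trans
        (mul_le_of_le_one_right h0 (by linarith))
    rw [hσ0 f hf hu hv]; exact h0
  refine ⟨z, σ, hz, hz1, fun f hf hu => ⟨(hσu f hf hu).1, (hσu f hf hu).2.trans (min_le_right _ _)⟩,
    fun f hf hv => ⟨(hσv f hf hv).1, (hσv f hf hv).2.trans (min_le_right _ _)⟩, hσ0, ?_⟩
  refine good_shift hg (hE.mono (Finset.subset_insert _ _)) huv he (disjoint_comp hD huD hvD)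
    hub hvb hz hσ hσx hσ0 (fun f hf hu => (hσu f hf hu).2.trans (min_le_left _ _))
    (fun f hf hv => (hσv f hf hv).2.trans (min_le_left _ _)) ?_ ?_ (hsum ▸ ht) (hsum ▸ hin) ?_ ?_
    hqu hqv (hlu ▸ hdu) (hlv ▸ hdv) (hsum ▸ hout) hou hov
  · intro p hp hpos
    have h1 := hσA _ hp (Sym2.mem_mk_left _ _)
    have h2 := hub.far p hp (hpos.trans_le
      ((hσu _ hp (Sym2.mem_mk_left _ _)).2.trans (min_le_left _ _)))
    have h3 := hAt (by linarith)
    exact add_le_of_le_cost hpos (by linarith)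
  · intro p hp hpos
    have h1 := hσB _ hp (Sym2.mem_mk_left _ _)
    have h2 := hvb.far p hp (hpos.trans_le
      ((hσv _ hp (Sym2.mem_mk_left _ _)).2.trans (min_le_left _ _)))
    have h3 := hBt (by linarith)
    exact add_le_of_le_cost hpos (by linarith)
  -- With B ≤ b(1-a), the new level is at most a + (1-a)(1-b) + b(1-a) = 1.
  · rw [hlu]; nlinarith
  · rw [hlv]; nlinarith

theorem Hub.sum_load_le {E : Finset (Sym2 V)} {x : Sym2 V → ℝ} (hg : Good E x) {u : V} {s : ℝ}
    {L : Sym2 V → ℝ} (h : Hub E x u s L) : ∑ f ∈ E with u ∈ f, L f ≤ 3 / 8 := by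
  refine (Finset.sum_le_sum fun f hf => ?_).trans (sum_bonus_le (E.filter (u ∈ ·)) x
    (fun f hf => hg.nonneg f (Finset.mem_filter.1 hf).1)
    (fun f hf => hg.le_cap f (Finset.mem_filter.1 hf).1) (hg.level_le u))
  exact h.load_le f (Finset.mem_filter.1 hf).1 (Finset.mem_filter.1 hf).2

theorem Hub.sum_load_nonneg {E : Finset (Sym2 V)} {x : Sym2 V → ℝ} {u : V} {s : ℝ}
    {L : Sym2 V → ℝ} (h : Hub E x u s L) : 0 ≤ ∑ f ∈ E with u ∈ f, L f :=
  Finset.sum_nonneg fun f hf =>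
    h.load_nonneg f (Finset.mem_filter.1 hf).1 (Finset.mem_filter.1 hf).2

/-- A load is at most the bonus, hence at most x f / 2; so the probability constraint x f · r costs
at most the factor 2r. -/
theorem Hub.mul_le_sum_min {E : Finset (Sym2 V)} {x : Sym2 V → ℝ} (hg : Good E x) {u : V} {s : ℝ}
    {L : Sym2 V → ℝ} (h : Hub E x u s L) {r : ℝ} (hr : 0 ≤ r) :
    (∑ f ∈ E with u ∈ f, L f) * min 1 (2 * r) ≤ ∑ f ∈ E with u ∈ f, min (L f) (x f * r) := by
  rw [Finset.sum_mul]
  refine Finset.sum_le_sum fun f hf => ?_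
  obtain ⟨hf, hu⟩ := Finset.mem_filter.1 hf
  have h0 := h.load_nonneg f hf hu
  have h1 := (h.load_le f hf hu).trans (bonus_le_half (hg.nonneg f hf))
  refine le_min (mul_le_of_le_one_right h0 (min_le_left _ _)) ?_
  exact (mul_le_mul_of_nonneg_left (min_le_right _ _) h0).trans (by nlinarith)

/-- The isolated end has s = -1/4, which raises the target from 3/8 to 5/8, and it contributes no
old surplus. -/
theorem exists_step_leaf {E : Finset (Sym2 V)} {x : Sym2 V → ℝ} (hg : Good E x) {u v : V}
    (hE : Bridged (insert s(u, v) E)) (he : s(u, v) ∉ E) (hu : ∃ f ∈ E, u ∈ f)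
    (hv : ¬ ∃ f ∈ E, v ∈ f) : ∃ z σ, IsStep E x u v z σ := by
  have hEE := hE.mono (Finset.subset_insert s(u, v) E)
  have hv' : ∀ f ∈ E, v ∉ f := fun f hf h => hv ⟨f, hf, h⟩
  obtain ⟨s, L, hub⟩ := exists_hub hg hEE hu
  have hb : level E x v = 0 := level_eq_zero hv'
  have hs := hub.nonneg hg hu
  have hL1 := hub.sum_load_le hg
  have hL0 := hub.sum_load_nonneg
  obtain ⟨z, A, hz, hA, hza, hAL, hA38, ht, hin, hst⟩ :=
    exists_leaf_amounts (hg.level_le u) hL0 hL1 hs (hub.cost_le hu)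
  refine exists_step_of_amounts hg hE he hub (hub_of_isolated hv') hz hA le_rfl (B := 0) ?_ ?_ ?_ ?_
    ?_ ?_ ?_ rfl rfl rfl rfl ?_ ?_ ?_
  · rw [hb]; linarith
  · refine hAL.trans (Finset.sum_le_sum fun f hf => le_min le_rfl ?_)
    obtain ⟨hf, huf⟩ := Finset.mem_filter.1 hf
    have h1 := bonus_le_half (hg.nonneg f hf)
    rw [hb, sub_zero, mul_one]
    linarith [hub.load_le f hf huf, hg.nonneg f hf]
  · rw [Finset.filter_false_of_mem hv', Finset.sum_empty]
  · linarith
  · linarith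
  · intro h
    linarith [hst (by linarith)]
  · intro h; exact absurd h (lt_irrefl _)
  · rw [if_pos hu, if_neg hv, hb, cost_of_le (t := 0) (by norm_num)]
    have h1 := cost_sub_le (t := level E x u) (r := level E x u + z + 0) (by linarith)
    -- The bonus of the new edge pays for the new leaf: t - 3/8 ≤ (t - 1/8)/2 holds exactly for t ≤
    -- 5/8.
    have h2 : cost (0 + z + A) ≤ bonus (z + A + 0) :=
      max_le (bonus_nonneg _) (by linarith [le_bonus (z + A + 0)])
    linarith
  · intro _
    rw [if_pos hu, if_neg hv, hb, cost_of_le (t := 0) (by norm_num)]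
    have h2 : cost (0 + z + A) ≤ z := max_le hz (by linarith)
    linarith
  · exact fun h => absurd h hv

theorem exists_step {E : Finset (Sym2 V)} {x : Sym2 V → ℝ} (hg : Good E x) {u v : V}
    (hE : Bridged (insert s(u, v) E)) (he : s(u, v) ∉ E) : ∃ z σ, IsStep E x u v z σ := by
  have hEE := hE.mono (Finset.subset_insert s(u, v) E)
  by_cases hu : ∃ f ∈ E, u ∈ f <;> by_cases hv : ∃ f ∈ E, v ∈ f
  · obtain ⟨su, Lu, hub⟩ := exists_hub hg hEE hu
    obtain ⟨sv, Lv, hvb⟩ := exists_hub hg hEE hv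
    have ha := hg.level_le u
    have hb := hg.level_le v
    have hsu := hub.nonneg hg hu
    have hsv := hvb.nonneg hg hv
    have hMu := hub.mul_le_sum_min hg (r := 1 - level E x v) (by linarith)
    have hMv := hvb.mul_le_sum_min hg (r := 1 - level E x u) (by linarith)
    have hMu0 : 0 ≤ ∑ f ∈ E with u ∈ f, min (Lu f) (x f * (1 - level E x v)) :=
      (mul_nonneg hub.sum_load_nonneg (le_min zero_le_one (by linarith))).trans hMu
    have hMv0 : 0 ≤ ∑ f ∈ E with v ∈ f, min (Lv f) (x f * (1 - level E x u)) :=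
      (mul_nonneg hvb.sum_load_nonneg (le_min zero_le_one (by linarith))).trans hMv
    obtain ⟨z, A, B, hz, hA, hB, hz1, hA1, hB1, hA4, hB4, ht, hin, hst⟩ :=
      exists_merge_amounts ha hb hMu0 hMv0 hsu hsv
        (merge_capacity ha hb hub.sum_load_nonneg (hub.sum_load_le hg) hvb.sum_load_nonneg
          (hvb.sum_load_le hg) hsu hsv (hub.cost_le hu) (hvb.cost_le hv) hMu hMv)
    have h1 := cost_sub_le (t := level E x u) (r := level E x u + z + B) (by linarith)
    have h2 := cost_sub_le (t := level E x v) (r := level E x v + z + A) (by linarith)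
    refine exists_step_of_amounts hg hE he hub hvb hz hA hB hz1 hA1 hB1 (by linarith) hin
      (fun h => by linarith [hst (by linarith)]) (fun h => by linarith [hst (by linarith)])
      rfl rfl rfl rfl ?_ ?_ ?_
    -- Two surpluses are available, and 1/2 + (t - 1/8)/2 - t ≥ 1/4 amounts to t ≤ 3/8.
    · rw [if_pos hu, if_pos hv]
      linarith [le_bonus (z + A + B)]
    · intro _
      rw [if_pos hu, if_pos hv]
      linarith
    · intro _
      rw [if_pos hu, if_pos hv]
      linarith
  · exact exists_step_leaf hg hE he hu hv
  · rw [Sym2.eq_swap] at hE he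
    obtain ⟨z, σ, h⟩ := exists_step_leaf hg hE he hv hu
    exact ⟨z, σ, h.symm⟩
  · have hu' : ∀ f ∈ E, u ∉ f := fun f hf h => hu ⟨f, hf, h⟩
    have hv' : ∀ f ∈ E, v ∉ f := fun f hf h => hv ⟨f, hf, h⟩
    -- For a new tree the value 7/8 is forced: matchings containing the edge need at least 7/8, and
    -- the cap allows no more.
    refine exists_step_of_amounts hg hE he (hub_of_isolated hu') (hub_of_isolated hv')
      (z := 7 / 8) (A := 0) (B := 0) (by norm_num) le_rfl le_rfl ?_ ?_ ?_ (by norm_num)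
      (by norm_num) (fun h => absurd h (lt_irrefl _)) (fun h => absurd h (lt_irrefl _))
      rfl rfl rfl rfl ?_ (fun h => absurd h hu) (fun h => absurd h hv)
    · rw [level_eq_zero hu', level_eq_zero hv']; norm_num
    · rw [Finset.filter_false_of_mem hu', Finset.sum_empty]
    · rw [Finset.filter_false_of_mem hv', Finset.sum_empty]
    · rw [if_neg hu, if_neg hv, level_eq_zero hu', level_eq_zero hv',
        cost_of_le (t := 0) (by norm_num), cost_of_ge (by norm_num), bonus_of_ge (by norm_num)]
      norm_num

end Step

/-! ### Forests and the bound on the maximum matching. -/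

section Forest

open Classical

variable {V : Type*}

theorem bridged_of_isForestInput {l : List (Sym2 V)} (h : IsForestInput l) :
    Bridged l.toFinset := by
  rintro f hf u p rfl
  rw [List.mem_toFinset] at hf
  obtain ⟨-, hdiag, hac⟩ := h
  have hup : u ≠ p := fun h => hdiag _ hf h
  refine ⟨hup, ?_⟩
  set G := SimpleGraph.fromEdgeSet {e | e ∈ l} with hG
  have hbr : ¬ (G.deleteEdges {s(u, p)}).Reachable u p :=
    SimpleGraph.isBridge_iff.1 (SimpleGraph.isAcyclic_iff_forall_adj_isBridge.1 hac
      ((SimpleGraph.fromEdgeSet_adj _).2 ⟨hf, hup⟩))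
  -- Every edge of an acyclic graph is a bridge; the separating set is the side of p after its
  -- deletion.
  refine ⟨(verts l.toFinset).filter fun w => (G.deleteEdges {s(u, p)}).Reachable p w, ?_, ?_, ?_⟩
  · exact fun h => hbr (Finset.mem_filter.1 h).2.symm
  · exact Finset.mem_filter.2 ⟨mem_verts.2 ⟨_, List.mem_toFinset.2 hf, Sym2.mem_mk_right _ _⟩,
      SimpleGraph.Reachable.refl _⟩
  · intro g hg w hw hwB w' hw'
    rw [Finset.mem_erase, List.mem_toFinset] at hg
    refine Finset.mem_filter.2 ⟨mem_verts.2 ⟨g, List.mem_toFinset.2 hg.2, hw'⟩, ?_⟩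
    have hr := (Finset.mem_filter.1 hwB).2
    by_cases hww : w = w'
    · rwa [← hww]
    · have hge : g = s(w, w') := (Sym2.mem_and_mem_iff hww).1 ⟨hw, hw'⟩
      subst hge
      refine hr.trans (SimpleGraph.Adj.reachable ?_)
      rw [SimpleGraph.deleteEdges_adj, SimpleGraph.fromEdgeSet_adj]
      exact ⟨⟨hg.2, hww⟩, hg.1⟩

/-- The invariant bounds every matching. -/
theorem card_le_of_good {E : Finset (Sym2 V)} {x : Sym2 V → ℝ} (hg : Good E x) (hE : Bridged E)
    {N : Finset (Sym2 V)} (hN : N ⊆ E) (hNm : IsEdgeMatching N)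
    (hmax : ∀ f ∈ E, ¬ Misses f (coveredSet N)) : 5 / 8 * (N.card : ℝ) ≤ ∑ f ∈ E, x f := by
  have hpos : 0 ≤ potential E x (verts E) (coveredSet N) :=
    potential_nonneg hg (fun f hf _ _ _ w hw => mem_verts.2 ⟨f, hf, hw⟩) hN hNm
  have h1 : ∑ f ∈ E with ∀ w ∈ f, w ∈ verts E, edgeCredit x (coveredSet N) f = ∑ f ∈ E, x f := by
    rw [Finset.filter_true_of_mem fun f hf w hw => mem_verts.2 ⟨f, hf, hw⟩]
    refine Finset.sum_congr rfl fun f hf => ?_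
    rw [edgeCredit, if_neg (hmax f hf), add_zero]
  have hcard : (verts N).card = 2 * N.card := by
    rw [verts, Finset.card_biUnion]
    · rw [Finset.sum_congr rfl fun f hf => Sym2.card_toFinset_of_not_isDiag f ?_]
      · rw [Finset.sum_const, smul_eq_mul, mul_comm]
      · have := hE f (hN hf)
        induction f using Sym2.ind with
        | _ a b => exact fun h => (this a b rfl).1 h
    · intro f hf g hg hne
      refine Finset.disjoint_left.2 fun w hw hw' => ?_
      exact hne (hNm f hf g hg w (Sym2.mem_toFinset.1 hw) (Sym2.mem_toFinset.1 hw'))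
  have h2 : 5 / 8 * (N.card : ℝ) ≤ ∑ w ∈ verts E, vertexCharge E x (coveredSet N) w := by
    have hsub : verts N ⊆ verts E := by
      intro w hw
      obtain ⟨f, hf, hwf⟩ := mem_verts.1 hw
      exact mem_verts.2 ⟨f, hN hf, hwf⟩
    refine le_trans ?_ (Finset.sum_le_sum_of_subset_of_nonneg hsub fun w _ _ => ?_)
    · have : ∀ w ∈ verts N, vertexCharge E x (coveredSet N) w = 5 / 16 :=
        fun w hw => if_pos (mem_verts.1 hw)
      rw [Finset.sum_congr rfl this, Finset.sum_const, hcard, nsmul_eq_mul]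
      push_cast
      linarith
    · rw [vertexCharge]
      split_ifs
      · norm_num
      · exact cost_nonneg _
  rw [potential, h1] at hpos
  linarith

theorem maxMatchingSize_le_of_good {l : List (Sym2 V)} {x : Sym2 V → ℝ}
    (hg : Good l.toFinset x) (hE : Bridged l.toFinset) :
    5 / 8 * (maxMatchingSize l : ℝ) ≤ ∑ f ∈ l.toFinset, x f := by
  obtain ⟨N, hN, hsup⟩ := Finset.exists_mem_eq_sup
    (l.toFinset.powerset.filter IsEdgeMatching) ⟨∅, by simp [IsEdgeMatching]⟩ Finset.card
  rw [Finset.mem_filter, Finset.mem_powerset] at hN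
  have hmax : maxMatchingSize l = N.card := by
    rw [← hsup, maxMatchingSize]
  rw [hmax]
  -- A maximum matching misses no edge, since a missed edge could be added; so no bonus occurs.
  refine card_le_of_good hg hE hN.1 hN.2 fun f hf hm => ?_
  have hfN : f ∉ N := by
    intro hfN
    induction f using Sym2.ind with
    | _ a b => exact hm a (Sym2.mem_mk_left _ _) ⟨_, hfN, Sym2.mem_mk_left _ _⟩
  have h1 : (insert f N).card ≤ (l.toFinset.powerset.filter IsEdgeMatching).sup Finset.card :=
    Finset.le_sup (f := Finset.card) (Finset.mem_filter.2 ⟨Finset.mem_powerset.2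
      (Finset.insert_subset hf hN.1), isEdgeMatching_insert hN.2 hm⟩)
  rw [hsup, Finset.card_insert_of_notMem hfN] at h1
  omega

theorem level_congr {E : Finset (Sym2 V)} {x y : Sym2 V → ℝ} (h : ∀ f ∈ E, x f = y f) (w : V) :
    level E x w = level E y w :=
  Finset.sum_congr rfl fun f hf => h f (Finset.mem_filter.1 hf).1

theorem Good.congr {E : Finset (Sym2 V)} {x y : Sym2 V → ℝ} (hg : Good E x)
    (h : ∀ f ∈ E, x f = y f) : Good E y where
  nonneg f hf := h f hf ▸ hg.nonneg f hf
  le_cap f hf := h f hf ▸ hg.le_cap f hf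
  level_le w := level_congr h w ▸ hg.level_le w
  surplus W hW hWe N hN hNm := by
    have := hg.surplus W hW hWe N hN hNm
    have h1 : potential E x W (coveredSet N) = potential E y W (coveredSet N) := by
      unfold potential
      congr 1
      · refine Finset.sum_congr rfl fun f hf => ?_
        rw [edgeCredit, edgeCredit, h f (Finset.mem_filter.1 hf).1]
      · refine Finset.sum_congr rfl fun w _ => ?_
        rw [vertexCharge, vertexCharge, level_congr h]
    rwa [h1] at this

theorem good_empty (x : Sym2 V → ℝ) : Good (∅ : Finset (Sym2 V)) x where
  nonneg f hf := absurd hf (Finset.notMem_empty f)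
  le_cap f hf := absurd hf (Finset.notMem_empty f)
  level_le w := by simp [level]
  surplus W _ hWe := by
    obtain ⟨f, hf, -⟩ := hWe
    exact absurd hf (Finset.notMem_empty f)

/-! ### From fractional steps to acceptance probabilities. -/

/-- The edges share a vertex. -/
def Touches (e f : Sym2 V) : Prop := ∃ w ∈ e, w ∈ f

/-- The probability that all ends of `e` outside `f` are free. -/
noncomputable def freeWeight (E : Finset (Sym2 V)) (x : Sym2 V → ℝ) (e : Sym2 V) (c : Set V) : ℝ :=
  ∏ w ∈ e.toFinset with w ∉ c, (1 - level E x w)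

/-- The gain of `e` when it is accepted with probability `r` if both of its ends are free. -/
noncomputable def gainAt (E : Finset (Sym2 V)) (x : Sym2 V → ℝ) (e : Sym2 V) (r : ℝ) : ℝ :=
  r * freeWeight E x e ∅

/-- The loss of `f` when `e` replaces it with probability `r f` if it is the only obstacle. -/
noncomputable def lossAt (E : Finset (Sym2 V)) (x : Sym2 V → ℝ) (e : Sym2 V) (r : Sym2 V → ℝ)
    (f : Sym2 V) : ℝ :=
  if Touches e f then r f * (x f * freeWeight E x e {w | w ∈ f}) else 0

/-- Acceptance probabilities under which the invariant is preserved. -/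
def IsRates (E : Finset (Sym2 V)) (x : Sym2 V → ℝ) (e : Sym2 V) (r : ℝ × (Sym2 V → ℝ)) : Prop :=
  (0 ≤ r.1 ∧ r.1 ≤ 1) ∧ (∀ f, 0 ≤ r.2 f ∧ r.2 f ≤ 1) ∧
  Good (insert e E) (shift E x e (gainAt E x e r.1) (lossAt E x e r.2))

theorem freeWeight_mk_empty {E : Finset (Sym2 V)} {x : Sym2 V → ℝ} {u v : V} (huv : u ≠ v) :
    freeWeight E x s(u, v) ∅ = (1 - level E x u) * (1 - level E x v) := by
  rw [← Finset.prod_pair (f := fun w => 1 - level E x w) huv, ← Sym2.toFinset_mk_eq]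
  refine Finset.prod_congr ?_ fun _ _ => rfl
  ext w
  simp

theorem freeWeight_mk_of_mem {E : Finset (Sym2 V)} {x : Sym2 V → ℝ} {u v : V} {c : Set V}
    (hu : u ∈ c) (hv : v ∉ c) : freeWeight E x s(u, v) c = 1 - level E x v := by
  have : (s(u, v).toFinset).filter (· ∉ c) = {v} := by
    ext w
    rw [Finset.mem_filter, Sym2.mem_toFinset, Sym2.mem_iff, Finset.mem_singleton]
    constructor
    · rintro ⟨rfl | rfl, hw⟩
      · exact absurd hu hw
      · rfl
    · rintro rfl
      exact ⟨Or.inr rfl, hv⟩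
  rw [freeWeight, this, Finset.prod_singleton]

/-- An event of probability b = 0 forces a = 0, and division by zero then yields the harmless rate
0. -/
theorem div_mem_unit {a b : ℝ} (ha : 0 ≤ a) (hab : a ≤ b) :
    (0 ≤ a / b ∧ a / b ≤ 1) ∧ a / b * b = a := by
  rcases (ha.trans hab).eq_or_lt with h | h
  · have : a = 0 := by linarith
    simp [this]
  · exact ⟨⟨by positivity, (div_le_one h).2 hab⟩, div_mul_cancel₀ _ h.ne'⟩

/-- Each amount of the fractional step is divided by the probability of the situation in which it is
collected. -/
theorem exists_rates {E : Finset (Sym2 V)} {x : Sym2 V → ℝ} {e : Sym2 V} (hg : Good E x)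
    (hE : Bridged (insert e E)) (he : e ∉ E) : ∃ r, IsRates E x e r := by
  induction e using Sym2.ind with
  | _ u v =>
  obtain ⟨z, σ, hz, hz1, hσu, hσv, hσ0, hgood⟩ := exists_step hg hE he
  have huv : u ≠ v := (hE _ (Finset.mem_insert_self _ _) u v rfl).1
  have hloss : ∀ f ∈ E, Touches s(u, v) f →
      0 ≤ σ f ∧ σ f ≤ x f * freeWeight E x s(u, v) {w | w ∈ f} := by
    rintro f hf ⟨w, hw, hwf⟩
    rcases Sym2.mem_iff.1 hw with rfl | rfl
    · rw [freeWeight_mk_of_mem (c := {w | w ∈ f}) hwf]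
      · exact hσu f hf hwf
      · exact fun hv => he (((Sym2.mem_and_mem_iff huv).1 ⟨hwf, hv⟩) ▸ hf)
    · rw [Sym2.eq_swap, freeWeight_mk_of_mem (c := {w | w ∈ f}) hwf]
      · exact hσv f hf hwf
      · exact fun hu => he (((Sym2.mem_and_mem_iff huv).1 ⟨hu, hwf⟩) ▸ hf)
  refine ⟨(z / freeWeight E x s(u, v) ∅, fun f => if f ∈ E ∧ Touches s(u, v) f then
    σ f / (x f * freeWeight E x s(u, v) {w | w ∈ f}) else 0), ?_, ?_, ?_⟩
  · rw [freeWeight_mk_empty huv]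
    exact (div_mem_unit hz hz1).1
  · intro f
    dsimp only
    split_ifs with h
    · obtain ⟨h1, h2⟩ := hloss f h.1 h.2
      exact (div_mem_unit h1 h2).1
    · exact ⟨le_rfl, zero_le_one⟩
  · have h1 : gainAt E x s(u, v) (z / freeWeight E x s(u, v) ∅) = z := by
      rw [gainAt, freeWeight_mk_empty huv]
      exact (div_mem_unit hz hz1).2
    have h2 : ∀ f ∈ E, σ f = lossAt E x s(u, v) (fun f => if f ∈ E ∧ Touches s(u, v) f then
        σ f / (x f * freeWeight E x s(u, v) {w | w ∈ f}) else 0) f := by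
      intro f hf
      rw [lossAt]
      split_ifs with h h'
      · obtain ⟨h1, h2⟩ := hloss f hf h
        exact ((div_mem_unit h1 h2).2).symm
      · exact absurd ⟨hf, h⟩ h'
      · refine hσ0 f hf (fun hu => h ⟨u, Sym2.mem_mk_left _ _, hu⟩)
          (fun hv => h ⟨v, Sym2.mem_mk_right _ _, hv⟩)
    refine hgood.congr fun f hf => ?_
    rw [h1]
    unfold shift
    split_ifs with hfe
    · rw [Finset.sum_congr rfl h2]
    · rw [h2 f ((Finset.mem_insert.1 hf).resolve_left hfe)]

/-- The acceptance probabilities of the algorithm. -/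
noncomputable def rates (E : Finset (Sym2 V)) (x : Sym2 V → ℝ) (e : Sym2 V) : ℝ × (Sym2 V → ℝ) :=
  -- The default makes the algorithm total; on forest inputs `exists_rates` excludes it.
  if h : ∃ r, IsRates E x e r then h.choose else (0, fun _ => 0)

theorem rates_fst_mem (E : Finset (Sym2 V)) (x : Sym2 V → ℝ) (e : Sym2 V) :
    0 ≤ (rates E x e).1 ∧ (rates E x e).1 ≤ 1 := by
  unfold rates
  split_ifs with h
  · exact h.choose_spec.1
  · norm_num

theorem rates_snd_mem (E : Finset (Sym2 V)) (x : Sym2 V → ℝ) (e f : Sym2 V) :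
    0 ≤ (rates E x e).2 f ∧ (rates E x e).2 f ≤ 1 := by
  unfold rates
  split_ifs with h
  · exact h.choose_spec.2.1 f
  · norm_num

/-- The probabilities with which the algorithm holds the edges of `l`, latest arrival first. -/
noncomputable def weights : List (Sym2 V) → Sym2 V → ℝ
  | [] => 0
  | e :: l => shift l.toFinset (weights l) e
      (gainAt l.toFinset (weights l) e (rates l.toFinset (weights l) e).1)
      (lossAt l.toFinset (weights l) e (rates l.toFinset (weights l) e).2)

theorem good_weights {l : List (Sym2 V)} (hl : l.Nodup) (hE : Bridged l.toFinset) :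
    Good l.toFinset (weights l) := by
  induction l with
  | nil => exact good_empty _
  | cons e l ih =>
    rw [List.nodup_cons] at hl
    rw [List.toFinset_cons] at hE ⊢
    have hg := ih hl.2 (hE.mono (Finset.subset_insert _ _))
    have hex := exists_rates hg hE (by rw [List.mem_toFinset]; exact hl.1)
    have := hex.choose_spec.2.2
    rw [weights, rates, dif_pos hex]
    exact this

end Forest

/-! ### The law of the held matching and independence across components. -/

section Law

open Classical

variable {V : Type*}

/-- The held edges that obstruct `e`. -/
noncomputable def blockers (e : Sym2 V) (M : Finset (Sym2 V)) : Finset (Sym2 V) :=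
  M.filter (Touches e)

/-- The probability of accepting an edge with obstacles `K`. -/
noncomputable def accept (r : ℝ × (Sym2 V → ℝ)) (K : Finset (Sym2 V)) : ℝ :=
  -- The sum merely reads off the rate of the unique obstacle; with two obstacles the edge is
  -- rejected.
  if K = ∅ then r.1 else if K.card = 1 then ∑ f ∈ K, r.2 f else 0

/-- The matching after accepting `e`. -/
noncomputable def replace (e : Sym2 V) (M : Finset (Sym2 V)) : Finset (Sym2 V) :=
  insert e (M.filter fun f => ¬ Touches e f)

/-- The acceptance probability of the algorithm. -/
noncomputable def acceptProb (l : List (Sym2 V)) (e : Sym2 V) (M : Finset (Sym2 V)) : ℝ :=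
  accept (rates l.toFinset (weights l) e) (blockers e M)

theorem acceptProb_mem (l : List (Sym2 V)) (e : Sym2 V) (M : Finset (Sym2 V)) :
    0 ≤ acceptProb l e M ∧ acceptProb l e M ≤ 1 := by
  unfold acceptProb accept
  split_ifs with h1 h2
  · exact rates_fst_mem _ _ _
  · obtain ⟨f, hf⟩ := Finset.card_eq_one.1 h2
    rw [hf, Finset.sum_singleton]
    exact rates_snd_mem _ _ _ _
  · norm_num

/-- The expectation of a function of the held matching, after the arrival of `l`, latest arrival
first. -/
noncomputable def law : List (Sym2 V) → (Finset (Sym2 V) → ℝ) → ℝ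
  | [], F => F ∅
  | e :: l, F => law l fun M =>
      (1 - acceptProb l e M) * F M + acceptProb l e M * F (replace e M)

theorem law_add (l : List (Sym2 V)) (F G : Finset (Sym2 V) → ℝ) :
    law l (fun M => F M + G M) = law l F + law l G := by
  induction l generalizing F G with
  | nil => rfl
  | cons e l ih =>
    simp only [law]
    rw [← ih]
    congr 1
    funext M
    ring

theorem law_const_mul (l : List (Sym2 V)) (c : ℝ) (F : Finset (Sym2 V) → ℝ) :
    law l (fun M => c * F M) = c * law l F := by
  induction l generalizing F with
  | nil => rfl
  | cons e l ih =>
    simp only [law]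
    rw [← ih]
    congr 1
    funext M
    ring

theorem law_const (l : List (Sym2 V)) (c : ℝ) : law l (fun _ => c) = c := by
  induction l with
  | nil => rfl
  | cons e l ih =>
    simp only [law]
    rw [← ih]
    congr 1
    funext M
    rw [ih]
    ring

theorem law_sub (l : List (Sym2 V)) (F G : Finset (Sym2 V) → ℝ) :
    law l (fun M => F M - G M) = law l F - law l G := by
  have h := law_add l (fun M => F M - G M) G
  simp only [sub_add_cancel] at h
  linarith

theorem law_sum {ι : Type*} (l : List (Sym2 V)) (I : Finset ι) (F : ι → Finset (Sym2 V) → ℝ) :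
    law l (fun M => ∑ i ∈ I, F i M) = ∑ i ∈ I, law l (F i) := by
  induction I using Finset.induction_on with
  | empty => simpa using law_const l 0
  | insert i I hi ih =>
    simp only [Finset.sum_insert hi]
    rw [law_add, ih]

theorem replace_subset {e : Sym2 V} {l : List (Sym2 V)} {M : Finset (Sym2 V)}
    (hM : M ⊆ l.toFinset) : replace e M ⊆ (e :: l).toFinset := by
  rw [List.toFinset_cons]
  exact Finset.insert_subset_insert _ ((Finset.filter_subset _ _).trans hM)

theorem isEdgeMatching_replace {e : Sym2 V} {M : Finset (Sym2 V)} (hM : IsEdgeMatching M) :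
    IsEdgeMatching (replace e M) := by
  refine isEdgeMatching_insert (hM.subset (Finset.filter_subset _ _)) ?_
  rintro w hw ⟨f, hf, hwf⟩
  exact (Finset.mem_filter.1 hf).2 ⟨w, hw, hwf⟩

theorem law_congr {l : List (Sym2 V)} {F G : Finset (Sym2 V) → ℝ}
    (h : ∀ M ⊆ l.toFinset, IsEdgeMatching M → F M = G M) : law l F = law l G := by
  induction l generalizing F G with
  | nil => exact h ∅ (Finset.empty_subset _) (by simp [IsEdgeMatching])
  | cons e l ih =>
    simp only [law]
    refine ih fun M hM hMm => ?_
    rw [h M (hM.trans (by rw [List.toFinset_cons]; exact Finset.subset_insert _ _)) hMm,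
      h _ (replace_subset hM) (isEdgeMatching_replace hMm)]

/-- The decision about an edge on the `P` side reads and changes only that side, so it can be
absorbed into a new function `H` there, leaving the other factor untouched. -/
theorem law_mul_cons {l : List (Sym2 V)} {e : Sym2 V} {P Q : Sym2 V → Prop}
    (hPQ : ∀ f, Q f ↔ ¬ P f) (he : P e)
    (hP : ∀ f ∈ l, Touches e f → P f)
    (ih : ∀ F G : Finset (Sym2 V) → ℝ,
      law l (fun M => F (M.filter P) * G (M.filter Q)) =
        law l (fun M => F (M.filter P)) * law l (fun M => G (M.filter Q)))
    (F G : Finset (Sym2 V) → ℝ) :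
    law (e :: l) (fun M => F (M.filter P) * G (M.filter Q)) =
      law (e :: l) (fun M => F (M.filter P)) *
        law (e :: l) (fun M => G (M.filter Q)) := by
  let H : Finset (Sym2 V) → ℝ := fun K =>
    (1 - acceptProb l e K) * F K + acceptProb l e K * F (replace e K)
  have hα : ∀ M ⊆ l.toFinset, acceptProb l e (M.filter P) = acceptProb l e M := by
    intro M hM
    have : blockers e (M.filter P) = blockers e M := by
      ext f
      simp only [blockers, Finset.mem_filter]
      exact ⟨fun h => ⟨h.1.1, h.2⟩, fun h => ⟨⟨h.1, hP f (List.mem_toFinset.1 (hM h.1)) h.2⟩, h.2⟩⟩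
    rw [acceptProb, this, acceptProb]
  have h1 : ∀ M, (replace e M).filter P = replace e (M.filter P) := by
    intro M
    ext f
    simp only [replace, Finset.mem_filter, Finset.mem_insert]
    constructor
    · rintro ⟨rfl | h, h'⟩
      · exact Or.inl rfl
      · exact Or.inr ⟨⟨h.1, h'⟩, h.2⟩
    · rintro (rfl | h)
      · exact ⟨Or.inl rfl, he⟩
      · exact ⟨Or.inr ⟨h.1.1, h.2⟩, h.1.2⟩
  have h2 : ∀ M ⊆ l.toFinset, (replace e M).filter Q = M.filter Q := by
    intro M hM
    ext f
    simp only [replace, Finset.mem_filter, Finset.mem_insert]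
    constructor
    · rintro ⟨rfl | h, h'⟩
      · exact absurd he ((hPQ _).1 h')
      · exact ⟨h.1, h'⟩
    · rintro ⟨h, h'⟩
      exact ⟨Or.inr ⟨h, fun ht => (hPQ _).1 h' (hP f (List.mem_toFinset.1 (hM h)) ht)⟩, h'⟩
  have e1 : law (e :: l) (fun M => F (M.filter P) * G (M.filter Q)) =
      law l (fun M => H (M.filter P) * G (M.filter Q)) := by
    simp only [law]
    refine law_congr fun M hM _ => ?_
    simp only [H]
    rw [hα M hM, h1, h2 M hM]
    ring
  have e2 : law (e :: l) (fun M => F (M.filter P)) = law l (fun M => H (M.filter P)) := by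
    simp only [law]
    refine law_congr fun M hM _ => ?_
    simp only [H]
    rw [hα M hM, h1]
  have e3 : law (e :: l) (fun M => G (M.filter Q)) =
      law l (fun M => G (M.filter Q)) := by
    simp only [law]
    refine law_congr fun M hM _ => ?_
    rw [h2 M hM]
    ring
  rw [e1, e2, e3]
  exact ih H G

/-- The parts of the matching on two sides that share no vertex are independent. -/
theorem law_mul {l : List (Sym2 V)} {P Q : Sym2 V → Prop} (hPQ : ∀ f, Q f ↔ ¬ P f)
    (hP : ∀ e ∈ l, ∀ f ∈ l, Touches e f → (P e ↔ P f)) (F G : Finset (Sym2 V) → ℝ) :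
    law l (fun M => F (M.filter P) * G (M.filter Q)) =
      law l (fun M => F (M.filter P)) * law l (fun M => G (M.filter Q)) := by
  induction l generalizing F G with
  | nil => rfl
  | cons e l ih =>
    have hP' : ∀ e ∈ l, ∀ f ∈ l, Touches e f → (P e ↔ P f) := fun e he f hf =>
      hP e (List.mem_cons_of_mem _ he) f (List.mem_cons_of_mem _ hf)
    have hPe : ∀ f ∈ l, Touches e f → (P e ↔ P f) := fun f hf =>
      hP e List.mem_cons_self f (List.mem_cons_of_mem _ hf)
    by_cases he : P e
    · exact law_mul_cons hPQ he (fun f hf ht => (hPe f hf ht).1 he) (ih hP') F G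
    · have := law_mul_cons (P := Q) (Q := P) (fun f => by rw [hPQ, not_not]) ((hPQ e).2 he)
        (fun f hf ht => (hPQ f).2 ((not_congr (hPe f hf ht)).1 he)) (fun F G => by
          rw [mul_comm, ← ih hP' G F]
          congr 1
          funext M
          ring) G F
      rw [mul_comm, ← this]
      congr 1
      funext M
      ring

theorem law_mul_of_local {l : List (Sym2 V)} {P Q : Sym2 V → Prop} (hPQ : ∀ f, Q f ↔ ¬ P f)
    (hP : ∀ e ∈ l, ∀ f ∈ l, Touches e f → (P e ↔ P f)) {F G : Finset (Sym2 V) → ℝ}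
    (hF : ∀ M ⊆ l.toFinset, F (M.filter P) = F M)
    (hG : ∀ M ⊆ l.toFinset, G (M.filter Q) = G M) :
    law l (fun M => F M * G M) = law l F * law l G := by
  rw [← law_congr (F := fun M => F (M.filter P)) (fun M hM _ => hF M hM),
    ← law_congr (F := fun M => G (M.filter Q)) (fun M hM _ => hG M hM),
    ← law_mul hPQ hP]
  exact law_congr fun M hM _ => by rw [hF M hM, hG M hM]

/-- The indicator of `f ∈ M`. -/
noncomputable def memInd (f : Sym2 V) (M : Finset (Sym2 V)) : ℝ := if f ∈ M then 1 else 0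

/-- The indicator of `w` being free. -/
noncomputable def freeInd (w : V) (M : Finset (Sym2 V)) : ℝ := if w ∈ coveredSet M then 0 else 1

theorem freeInd_eq {E M : Finset (Sym2 V)} (hM : M ⊆ E) (hMm : IsEdgeMatching M) (w : V) :
    freeInd w M = 1 - ∑ f ∈ E with w ∈ f, memInd f M := by
  by_cases h : w ∈ coveredSet M
  · obtain ⟨g, hg, hw⟩ := h
    rw [Finset.sum_eq_single_of_mem g (Finset.mem_filter.2 ⟨hM hg, hw⟩), memInd, if_pos hg, freeInd,
      if_pos ⟨g, hg, hw⟩, sub_self]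
    intro f hf hne
    exact if_neg fun hfM => hne (hMm f hfM g hg w (Finset.mem_filter.1 hf).2 hw)
  · rw [freeInd, if_neg h, Finset.sum_eq_zero, sub_zero]
    intro f hf
    exact if_neg fun hfM => h ⟨f, hfM, (Finset.mem_filter.1 hf).2⟩

theorem law_freeInd {l : List (Sym2 V)} {x : Sym2 V → ℝ}
    (hx : ∀ f ∈ l.toFinset, law l (memInd f) = x f) (w : V) :
    law l (freeInd w) = 1 - level l.toFinset x w := by
  rw [law_congr (fun M hM hMm => freeInd_eq hM hMm w), law_sub, law_const, law_sum, level]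
  congr 1
  exact Finset.sum_congr rfl fun f hf => hx f (Finset.mem_filter.1 hf).1

theorem covered_filter {M : Finset (Sym2 V)} {P : Sym2 V → Prop} {w : V}
    (h : ∀ f ∈ M, w ∈ f → P f) : w ∈ coveredSet (M.filter P) ↔ w ∈ coveredSet M := by
  constructor
  · rintro ⟨f, hf, hw⟩
    exact ⟨f, (Finset.mem_filter.1 hf).1, hw⟩
  · rintro ⟨f, hf, hw⟩
    exact ⟨f, Finset.mem_filter.2 ⟨hf, h f hf hw⟩, hw⟩

/-- An edge on one side and a vertex on the other. -/
theorem law_memInd_mul_freeInd {l : List (Sym2 V)} {x : Sym2 V → ℝ}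
    (hx : ∀ f ∈ l.toFinset, law l (memInd f) = x f) {P Q : Sym2 V → Prop}
    (hPQ : ∀ f, Q f ↔ ¬ P f)
    (hP : ∀ e ∈ l, ∀ f ∈ l, Touches e f → (P e ↔ P f)) {f : Sym2 V} {v : V}
    (hf : f ∈ l.toFinset) (hPf : P f) (hv : ∀ g ∈ l, v ∈ g → Q g) :
    law l (fun M => memInd f M * freeInd v M) = x f * (1 - level l.toFinset x v) := by
  rw [law_mul_of_local hPQ hP, hx f hf, law_freeInd hx]
  · intro M _
    simp only [memInd, Finset.mem_filter, hPf, and_true]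
  · intro M hM
    simp only [freeInd]
    rw [covered_filter fun g hg => hv g (List.mem_toFinset.1 (hM hg))]

theorem law_freeInd_mul_freeInd {l : List (Sym2 V)} {x : Sym2 V → ℝ}
    (hx : ∀ f ∈ l.toFinset, law l (memInd f) = x f) {P Q : Sym2 V → Prop}
    (hPQ : ∀ f, Q f ↔ ¬ P f)
    (hP : ∀ e ∈ l, ∀ f ∈ l, Touches e f → (P e ↔ P f)) {u v : V}
    (hu : ∀ g ∈ l, u ∈ g → P g) (hv : ∀ g ∈ l, v ∈ g → Q g) :
    law l (fun M => freeInd u M * freeInd v M) =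
      (1 - level l.toFinset x u) * (1 - level l.toFinset x v) := by
  rw [law_mul_of_local hPQ hP, law_freeInd hx, law_freeInd hx]
  · intro M hM
    simp only [freeInd]
    rw [covered_filter fun g hg => hu g (List.mem_toFinset.1 (hM hg))]
  · intro M hM
    simp only [freeInd]
    rw [covered_filter fun g hg => hv g (List.mem_toFinset.1 (hM hg))]

theorem blockers_mk_eq_empty {u v : V} {M : Finset (Sym2 V)} :
    blockers s(u, v) M = ∅ ↔ u ∉ coveredSet M ∧ v ∉ coveredSet M := by
  rw [← misses_mk_iff, blockers, Finset.filter_eq_empty_iff]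
  constructor
  · rintro h w hw ⟨f, hf, hwf⟩
    exact h hf ⟨w, hw, hwf⟩
  · rintro h f hf ⟨w, hw, hwf⟩
    exact h w hw ⟨f, hf, hwf⟩

theorem blockers_mk_eq_singleton {u v : V} {M : Finset (Sym2 V)} (hM : IsEdgeMatching M)
    {f : Sym2 V} (hu : u ∈ f) (hv : v ∉ f) :
    blockers s(u, v) M = {f} ↔ f ∈ M ∧ v ∉ coveredSet M := by
  rw [Finset.ext_iff]
  simp only [blockers, Finset.mem_filter, Finset.mem_singleton]
  constructor
  · intro h
    refine ⟨((h f).2 rfl).1, ?_⟩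
    rintro ⟨g, hg, hvg⟩
    have := (h g).1 ⟨hg, v, Sym2.mem_mk_right _ _, hvg⟩
    exact hv (this ▸ hvg)
  · rintro ⟨hf, hvc⟩ g
    constructor
    · rintro ⟨hg, w, hw, hwg⟩
      rcases Sym2.mem_iff.1 hw with rfl | rfl
      · exact hM g hg f hf w hwg hu
      · exact absurd ⟨g, hg, hwg⟩ hvc
    · rintro rfl
      exact ⟨hf, u, Sym2.mem_mk_left _ _, hu⟩

/-- Writing the rate as a combination of indicators lets its expectation be computed from the
probabilities of the obstacle patterns. -/
theorem accept_eq (r : ℝ × (Sym2 V → ℝ)) (e : Sym2 V) {E M : Finset (Sym2 V)} (hM : M ⊆ E) :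
    accept r (blockers e M) = r.1 * (if blockers e M = ∅ then 1 else 0) +
      ∑ f ∈ E with Touches e f, r.2 f * (if blockers e M = {f} then 1 else 0) := by
  by_cases h0 : blockers e M = ∅
  · rw [h0, accept, if_pos rfl, if_pos rfl, Finset.sum_eq_zero, mul_one, add_zero]
    intro f _
    rw [if_neg (Finset.singleton_ne_empty f).symm, mul_zero]
  rw [accept, if_neg h0, if_neg h0, mul_zero, zero_add]
  by_cases h1 : (blockers e M).card = 1
  · obtain ⟨g, hg⟩ := Finset.card_eq_one.1 h1
    have hgM : g ∈ blockers e M := hg ▸ Finset.mem_singleton_self g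
    rw [blockers, Finset.mem_filter] at hgM
    rw [if_pos h1, hg, Finset.sum_singleton,
      Finset.sum_eq_single_of_mem g (Finset.mem_filter.2 ⟨hM hgM.1, hgM.2⟩), if_pos rfl, mul_one]
    intro f _ hne
    rw [if_neg (fun h => hne (Finset.singleton_injective h).symm), mul_zero]
  · rw [if_neg h1, Finset.sum_eq_zero]
    intro f _
    rw [if_neg, mul_zero]
    intro h
    exact h1 (by rw [h, Finset.card_singleton])

/-- A held edge that touches e is lost only if it is the sole obstacle, since otherwise the rate is
zero. -/
theorem accept_mul_memInd (r : ℝ × (Sym2 V → ℝ)) {e f : Sym2 V} (hf : Touches e f)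
    (M : Finset (Sym2 V)) :
    accept r (blockers e M) * memInd f M = r.2 f * (if blockers e M = {f} then 1 else 0) := by
  by_cases hfM : f ∈ M
  · have hfb : f ∈ blockers e M := Finset.mem_filter.2 ⟨hfM, hf⟩
    rw [memInd, if_pos hfM, mul_one, accept, if_neg (Finset.ne_empty_of_mem hfb)]
    by_cases h1 : (blockers e M).card = 1
    · obtain ⟨g, hg⟩ := Finset.card_eq_one.1 h1
      have : f = g := Finset.mem_singleton.1 (hg ▸ hfb)
      subst this
      rw [if_pos h1, hg, Finset.sum_singleton, if_pos rfl, mul_one]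
    · rw [if_neg h1, if_neg, mul_zero]
      intro h
      exact h1 (by rw [h, Finset.card_singleton])
  · rw [memInd, if_neg hfM, if_neg, mul_zero, mul_zero]
    intro h
    have : f ∈ blockers e M := h ▸ Finset.mem_singleton_self f
    exact hfM (Finset.mem_filter.1 this).1

/-- Before e arrives, its ends lie on two sides of a cut that no edge crosses; independence turns
each probability into a product. -/
theorem law_blockers {l : List (Sym2 V)} {x : Sym2 V → ℝ} {e : Sym2 V}
    (hx : ∀ f ∈ l.toFinset, law l (memInd f) = x f) (hE : Bridged (insert e l.toFinset))
    (he : e ∉ l.toFinset) :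
    law l (fun M => if blockers e M = ∅ then 1 else 0) = freeWeight l.toFinset x e ∅ ∧
    ∀ f ∈ l.toFinset, Touches e f → law l (fun M => if blockers e M = {f} then 1 else 0) =
      x f * freeWeight l.toFinset x e {w | w ∈ f} := by
  induction e using Sym2.ind with
  | _ u v =>
  obtain ⟨huv, B, huB, hvB, hB⟩ := hE _ (Finset.mem_insert_self _ _) u v rfl
  rw [Finset.erase_insert he] at hB
  have hcl : ∀ f ∈ l, ∀ g ∈ l, Touches f g → ((∃ w ∈ f, w ∈ B) ↔ ∃ w ∈ g, w ∈ B) := by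
    rintro f hf g hg ⟨y, hyf, hyg⟩
    constructor
    · rintro ⟨w, hw, hwB⟩
      exact ⟨y, hyg, hB f (List.mem_toFinset.2 hf) w hw hwB y hyf⟩
    · rintro ⟨w, hw, hwB⟩
      exact ⟨y, hyf, hB g (List.mem_toFinset.2 hg) w hw hwB y hyg⟩
  have hcl' : ∀ f ∈ l, ∀ g ∈ l, Touches f g → ((¬ ∃ w ∈ f, w ∈ B) ↔ ¬ ∃ w ∈ g, w ∈ B) :=
    fun f hf g hg h => not_congr (hcl f hf g hg h)
  have hu : ∀ g ∈ l, u ∈ g → ¬ ∃ w ∈ g, w ∈ B := by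
    rintro g hg hug ⟨w, hw, hwB⟩
    exact huB (hB g (List.mem_toFinset.2 hg) w hw hwB u hug)
  have hv : ∀ g ∈ l, v ∈ g → ∃ w ∈ g, w ∈ B := fun g _ hvg => ⟨v, hvg, hvB⟩
  have hPQ : ∀ f : Sym2 V, (∃ w ∈ f, w ∈ B) ↔ ¬ ¬ ∃ w ∈ f, w ∈ B := fun f => not_not.symm
  constructor
  · rw [freeWeight_mk_empty huv, ← law_freeInd_mul_freeInd hx hPQ hcl' hu hv]
    refine law_congr fun M _ _ => ?_
    by_cases h1 : u ∈ coveredSet M <;> by_cases h2 : v ∈ coveredSet M <;>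
      simp [blockers_mk_eq_empty, freeInd, h1, h2]
  · rintro f hf ⟨w, hw, hwf⟩
    rcases Sym2.mem_iff.1 hw with rfl | rfl
    · have hvf : v ∉ f := fun hv => he (((Sym2.mem_and_mem_iff huv).1 ⟨hwf, hv⟩) ▸ hf)
      rw [freeWeight_mk_of_mem (c := {w | w ∈ f}) hwf hvf, ← law_memInd_mul_freeInd hx hPQ hcl' hf
        (hu f (List.mem_toFinset.1 hf) hwf) hv]
      refine law_congr fun M _ hM => ?_
      by_cases h1 : f ∈ M <;> by_cases h2 : v ∈ coveredSet M <;>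
        simp [blockers_mk_eq_singleton hM hwf hvf, freeInd, memInd, h1, h2]
    · have huf : u ∉ f := fun hu => he (((Sym2.mem_and_mem_iff huv).1 ⟨hu, hwf⟩) ▸ hf)
      rw [Sym2.eq_swap, freeWeight_mk_of_mem (c := {w | w ∈ f}) hwf huf,
        ← law_memInd_mul_freeInd hx (fun _ => Iff.rfl) hcl hf (hv f (List.mem_toFinset.1 hf) hwf) hu]
      refine law_congr fun M _ hM => ?_
      by_cases h1 : f ∈ M <;> by_cases h2 : u ∈ coveredSet M <;>
        simp [blockers_mk_eq_singleton hM hwf huf, freeInd, memInd, h1, h2]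

/-- The algorithm holds every edge with the probability that the weights prescribe. -/
theorem law_memInd {l : List (Sym2 V)} (hl : l.Nodup) (hE : Bridged l.toFinset) :
    ∀ f ∈ l.toFinset, law l (memInd f) = weights l f := by
  induction l with
  | nil => intro f hf; simp at hf
  | cons e l ih =>
    rw [List.nodup_cons, ← List.mem_toFinset] at hl
    rw [List.toFinset_cons] at hE ⊢
    have hx := ih hl.2 (hE.mono (Finset.subset_insert _ _))
    obtain ⟨hnone, hone⟩ := law_blockers hx hE hl.1
    intro f hf
    simp only [law, weights]
    by_cases hfe : f = e
    · subst hfe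
      rw [shift_self]
      rw [law_congr (G := fun M => acceptProb l f M) fun M hM _ => ?_]
      · unfold acceptProb
        rw [law_congr (fun M hM _ => accept_eq _ f hM), law_add, law_const_mul, hnone, law_sum,
          gainAt, Finset.sum_filter]
        congr 1
        refine Finset.sum_congr rfl fun g hg => ?_
        rw [lossAt]
        split_ifs with h
        · rw [law_const_mul, hone g hg h]
        · rfl
      · rw [memInd, memInd, if_neg (fun h => hl.1 (hM h)), replace,
          if_pos (Finset.mem_insert_self _ _)]
        ring
    · have hfE := (Finset.mem_insert.1 hf).resolve_left hfe
      rw [shift_of_mem hl.1 hfE, lossAt]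
      split_ifs with ht
      · rw [← hone f hfE ht, ← law_const_mul, ← hx f hfE, ← law_sub]
        refine law_congr fun M _ _ => ?_
        rw [← accept_mul_memInd _ ht]
        have : memInd f (replace e M) = 0 := by simp [memInd, replace, hfe, ht]
        rw [this, acceptProb]
        ring
      · rw [sub_zero, ← hx f hfE]
        refine law_congr fun M _ _ => ?_
        have : memInd f (replace e M) = memInd f M := by simp [memInd, replace, hfe, ht]
        rw [this]
        ring

theorem law_card {l : List (Sym2 V)} (hl : l.Nodup) (hE : Bridged l.toFinset) :
    law l (fun M => (M.card : ℝ)) = ∑ f ∈ l.toFinset, weights l f := by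
  rw [← Finset.sum_congr rfl (law_memInd hl hE), ← law_sum]
  refine law_congr fun M hM _ => ?_
  simp only [memInd]
  rw [Finset.sum_boole, Finset.filter_mem_eq_inter, Finset.inter_eq_right.2 hM]

end Law

/-! ### The algorithm as a probability mass function on transcripts. -/

section Algorithm

open Classical

variable {V : Type*}

/-- A coin with success probability `a`. -/
noncomputable def coin (a : ℝ) (h : 0 ≤ a ∧ a ≤ 1) : PMF Bool :=
  PMF.ofFintype (fun b => ENNReal.ofReal (if b then a else 1 - a)) (by
    rw [Fintype.sum_bool, if_pos rfl, if_neg (by simp),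
      ← ENNReal.ofReal_add h.1 (by linarith [h.2]), add_sub_cancel, ENNReal.ofReal_one])

/-- Accept the arriving edge with the prescribed probability, and dispose of the obstacles. -/
noncomputable def matchingStep (h : Transcript V) (e : Sym2 V) : PMF (Finset (Sym2 V)) :=
  if IsEdgeMatching h.current then
    (coin (acceptProb (h.map Prod.fst) e h.current) (acceptProb_mem _ _ _)).map fun b =>
      if b then replace e h.current else h.current
  -- Needed only for transcripts that never occur, so that every step yields a matching.
  else PMF.pure ∅

theorem mem_support_matchingStep {h : Transcript V} {e : Sym2 V} {M : Finset (Sym2 V)}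
    (hM : M ∈ (matchingStep h e).support) :
    (IsEdgeMatching h.current ∧ (M = replace e h.current ∨ M = h.current)) ∨ M = ∅ := by
  unfold matchingStep at hM
  split_ifs at hM with hm
  · rw [PMF.mem_support_map_iff] at hM
    obtain ⟨b, -, rfl⟩ := hM
    left
    refine ⟨hm, ?_⟩
    cases b <;> simp
  · rw [PMF.mem_support_pure_iff] at hM
    exact Or.inr hM

/-- The algorithm. -/
noncomputable def forestAlgorithm (V : Type*) : RandomizedDisposalAlgorithm V where
  step := matchingStep
  mem_of_step h e M hM f hf := by
    rcases mem_support_matchingStep hM with ⟨-, rfl | rfl⟩ | rfl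
    · rcases Finset.mem_insert.1 hf with h | h
      · exact Or.inl h
      · exact Or.inr (Finset.mem_filter.1 h).1
    · exact Or.inr hf
    · exact absurd hf (Finset.notMem_empty f)
  isEdgeMatching_of_step h e M hM := by
    rcases mem_support_matchingStep hM with ⟨hm, rfl | rfl⟩ | rfl
    · exact isEdgeMatching_replace hm
    · exact hm
    · simp [IsEdgeMatching]

theorem run_append (A : RandomizedDisposalAlgorithm V) (σ : List (Sym2 V)) (e : Sym2 V) :
    A.run (σ ++ [e]) = (A.run σ).bind fun h => (A.step h e).map fun M => (e, M) :: h := by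
  rw [RandomizedDisposalAlgorithm.run, List.foldl_append]
  rfl

theorem tsum_bind_mul {α β : Type*} (p : PMF α) (f : α → PMF β) (g : β → ℝ≥0∞) :
    ∑' b, p.bind f b * g b = ∑' a, p a * ∑' b, f a b * g b := by
  simp_rw [PMF.bind_apply, ← ENNReal.tsum_mul_right, ← ENNReal.tsum_mul_left, mul_assoc]
  exact ENNReal.tsum_comm

theorem tsum_pure_mul {α : Type*} (a : α) (g : α → ℝ≥0∞) :
    ∑' b, (PMF.pure a) b * g b = g a := by
  rw [tsum_eq_single a]
  · simp
  · intro b hb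
    rw [PMF.pure_apply_of_ne _ _ hb, zero_mul]

theorem tsum_map_mul {α β : Type*} (p : PMF α) (f : α → β) (g : β → ℝ≥0∞) :
    ∑' b, p.map f b * g b = ∑' a, p a * g (f a) := by
  rw [PMF.map, tsum_bind_mul]
  simp_rw [Function.comp_apply, tsum_pure_mul]

theorem support_run {σ : List (Sym2 V)} {h : Transcript V}
    (hh : h ∈ ((forestAlgorithm V).run σ).support) :
    h.map Prod.fst = σ.reverse ∧ IsEdgeMatching h.current := by
  induction σ using List.reverseRecOn generalizing h with
  | nil =>
    rw [RandomizedDisposalAlgorithm.run, List.foldl_nil, PMF.mem_support_pure_iff] at hh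
    subst hh
    exact ⟨rfl, by simp [Transcript.current, IsEdgeMatching]⟩
  | append_singleton σ e ih =>
    rw [run_append, PMF.mem_support_bind_iff] at hh
    obtain ⟨h', hh', hmem⟩ := hh
    rw [PMF.mem_support_map_iff] at hmem
    obtain ⟨M, hM, rfl⟩ := hmem
    refine ⟨?_, (forestAlgorithm V).isEdgeMatching_of_step h' e M hM⟩
    rw [List.reverse_append, ← (ih hh').1]
    rfl

theorem current_cons (h : Transcript V) (e : Sym2 V) (M : Finset (Sym2 V)) :
    Transcript.current ((e, M) :: h) = M := rfl

/-- A step depends on the transcript only through the arrived edges and the current matching, and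
the edges are determined by σ; so `law`, fed with the latest arrival first, computes the
expectation. -/
theorem tsum_run_mul (σ : List (Sym2 V)) (F : Finset (Sym2 V) → ℝ) (hF : ∀ M, 0 ≤ F M) :
    ∑' h, (forestAlgorithm V).run σ h * ENNReal.ofReal (F h.current) =
      ENNReal.ofReal (law σ.reverse F) := by
  induction σ using List.reverseRecOn generalizing F with
  | nil =>
    rw [RandomizedDisposalAlgorithm.run, List.foldl_nil, tsum_pure_mul]
    rfl
  | append_singleton σ e ih =>
    rw [run_append, tsum_bind_mul, List.reverse_append, List.reverse_singleton,
      List.singleton_append, law, ← ih]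
    · refine tsum_congr fun h => ?_
      by_cases hh : (forestAlgorithm V).run σ h = 0
      · rw [hh, zero_mul, zero_mul]
      obtain ⟨hfst, hm⟩ := support_run ((PMF.mem_support_iff _ _).2 hh)
      congr 1
      have hα := acceptProb_mem σ.reverse e h.current
      have hstep : (forestAlgorithm V).step h e = (coin (acceptProb σ.reverse e h.current) hα).map
          fun b => if b then replace e h.current else h.current := by
        change matchingStep h e = _
        unfold matchingStep
        rw [if_pos hm]
        simp only [hfst]
      rw [tsum_map_mul, hstep, tsum_map_mul, tsum_fintype, Fintype.sum_bool]
      simp only [coin, PMF.ofFintype_apply, if_true, Bool.false_eq_true, if_false,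
        current_cons]
      rw [← ENNReal.ofReal_mul hα.1, ← ENNReal.ofReal_mul (by linarith [hα.2]),
        ← ENNReal.ofReal_add (mul_nonneg hα.1 (hF _)) (mul_nonneg (by linarith [hα.2]) (hF _)),
        add_comm]
    · intro M
      have hα := acceptProb_mem σ.reverse e M
      exact add_nonneg (mul_nonneg (by linarith [hα.2]) (hF _)) (mul_nonneg hα.1 (hF _))

theorem expectedSize_forestAlgorithm (σ : List (Sym2 V)) :
    (forestAlgorithm V).expectedSize σ =
      ENNReal.ofReal (law σ.reverse fun M => (M.card : ℝ)) := by
  rw [← tsum_run_mul σ _ fun M => Nat.cast_nonneg _, RandomizedDisposalAlgorithm.expectedSize]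
  simp only [ENNReal.ofReal_natCast]

end Algorithm

theorem theorem3 (V : Type*) :
    ∃ A : RandomizedDisposalAlgorithm V, A.IsCompetitiveOnForests (5 / 8) := by
  classical
  refine ⟨forestAlgorithm V, fun σ hσ => ?_⟩
  have hE : Bridged σ.reverse.toFinset := by
    rw [List.toFinset_reverse]
    convert bridged_of_isForestInput hσ
  have hl : σ.reverse.Nodup := List.nodup_reverse.2 hσ.1
  have hg : Good σ.reverse.toFinset (weights σ.reverse) := by
    convert good_weights (l := σ.reverse) hl (by convert hE)
  have hmax : maxMatchingSize σ.reverse = maxMatchingSize σ := by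
    rw [maxMatchingSize, maxMatchingSize, List.toFinset_reverse]
  have hle := maxMatchingSize_le_of_good (l := σ.reverse) (by convert hg) (by convert hE)
  rw [← law_card hl (by convert hE), hmax] at hle
  rw [expectedSize_forestAlgorithm]
  refine le_trans (le_of_eq ?_) (ENNReal.ofReal_le_ofReal hle)
  rw [ENNReal.ofReal_mul (by norm_num), ENNReal.ofReal_natCast,
    ENNReal.ofReal_div_of_pos (by norm_num)]
  norm_num
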